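/- **Model.** Macro base stations (MBSs) and small-cell base stations (SBSs) form independent homogeneous Poisson processes $\Phi_{\rm m},\Phi_{\rm s}$ in $\mathbb{R}^2$ with densities $\lambda_{\rm m},\lambda_{\rm s}>0$; the typical UE is at the origin. Every link of length $r$ is, independently of everything else, in line of sight (state $\ell$) with probability $e^{-r/\mu}$ and otherwise in state ${\rm n}$. An access link (UE to a BS of tier $i\in\{{\rm m},{\rm s}\}$) of length $r$ has pathloss $L=r^{\alpha_{{\rm a}_{i,t}}}$ in state $t$, and an MBS–SBS backhaul link has pathloss $r^{\alpha_{{\rm b}_{{\rm m},t}}}$. Every link has an independent fading $h\sim\exp(1)$. The parameters $\mu$, $\alpha_{\cdot}$, $P_i$ (powers), $T_i$ (biases), $\beta_{{\rm a}_i},\beta_{{\rm b}_{\rm m}}$ (reference losses), $G_i,G_{\rm u}$ (main-lobe gains), ${\tt N}_0$, $W$ are positive, the side-lobe gains $g_{\rm s},g_{\rm u}$ are nonnegative, and the beamwidths $\theta_{\rm s},\theta_{\rm u}$ lie in $[0,2\pi]$. The gain $\psi$ of each interfering SBS access link is independent and takes the values $\mathcal G=G_{\rm s}G_{\rm u},\,G_{\rm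 s}g_{\rm u},\,g_{\rm s}G_{\rm u},\,g_{\rm s}g_{\rm u}$ with probabilities $p_{\mathcal G}=\frac{\theta_{\rm s}\theta_{\rm u}}{4\pi^2},\frac{\theta_{\rm s}(2\pi-\theta_{\rm u})}{4\pi^2},\frac{(2\pi-\theta_{\rm s})\theta_{\rm u}}{4\pi^2},\frac{(2\pi-\theta_{\rm s})(2\pi-\theta_{\rm u})}{4\pi^2}$ (sums over $\mathcal G$ below run over these four cases). The UE is served by the BS ${\bf x}^*$ that maximizes $P_iT_i\beta_{{\rm a}_i}G_iG_{\rm u}L^{-1}$ over both tiers, and $\mathcal A_{\rm s}=\mathbb P({\bf x}^*\in\Phi_{\rm s})$. Neglecting MBS interference, for ${\bf x}^*\in\Phi_i$, $${\tt SINR}_{\rm a}({\bf 0})=\frac{P_iG_iG_{\rm u}\beta_{{\rm a}_i}h_{{\bf x}^*}L_{{\bf x}^*}^{-1}}{\sum_{{\bf x}\in\Phi_{\rm s}\setminus\{{\bf x}^*\}}P_{\rm s}h_{\bf x}\beta_{{\rm a}_{\rm s}}\psi_{\bf x}L_{\bf x}^{-1}+{\tt N}_0W},$$ with value $0$ if the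 interference sum is infinite. The backhaul SNR of an SBS at ${\bf y}$ is ${\tt SNR}_{\rm b}({\bf y})=P_{\rm m}G_{\rm m}G_{\rm s}\beta_{{\rm b}_{\rm m}}h\,L^{-1}/({\tt N}_0W)$, where $h,L$ are the fading and the pathloss of its link to the MBS of smallest backhaul pathloss. ${\tt SNR}_{\rm b}({\bf x}^*)$ is that of the serving SBS (tagged link), and ${\tt SNR}_{\rm b}({\bf 0})$ is that of a typical SBS at the origin with link states and fadings of its own (typical link). For a density $\lambda$ and exponents $\alpha=(\alpha_\ell,\alpha_{\rm n})$ put, for $l>0$, $$\Lambda(l)=2\pi\lambda\Big[\mu\big(\mu-e^{-l^{1/\alpha_\ell}/\mu}(l^{1/\alpha_\ell}+\mu)\big)+\tfrac12l^{2/\alpha_{\rm n}}-\mu\big(\mu-e^{-l^{1/\alpha_{\rm n}}/\mu}(l^{1/\alpha_{\rm n}}+\mu)\big)\Big],$$ $$\Lambda'(l)=2\pi\lambda\Big[\tfrac1{\alpha_\ell}l^{2/\alpha_\ell-1}e^{-l^{1/\alpha_\ell}/\mu}+\tfrac1{\alpha_{\rm n}}l^{2/\alpha_{\rm n}-1}\big(1-e^{-l^{1/\alpha_{\rm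 n}}/\mu}\big)\Big].$$ Write $\Lambda_{{\rm a}_i}((0,l])$, $\lambda_{{\rm a}_i}(l)$ for these with $\lambda_i$ and the exponents $\alpha_{{\rm a}_{i,\cdot}}$; write $\Lambda_{{\rm b}_{\rm m}}((0,l])$, $\lambda_{{\rm b}_{\rm m}}(l)$ for these with $\lambda_{\rm m}$ and the exponents $\alpha_{{\rm b}_{{\rm m},\cdot}}$. Let $\Omega_{j,{\rm s}}=\frac{P_jT_j\beta_{{\rm a}_j}G_j}{P_{\rm s}T_{\rm s}\beta_{{\rm a}_{\rm s}}G_{\rm s}}$. **Statement.** Let $\tau_1>0$ and $\tau_2\ge0$. Then (with $e^{-\infty}=0$) $$\mathbb P({\tt SINR}_{\rm a}({\bf 0})>\tau_1\mid{\bf x}^*\in\Phi_{\rm s})=\frac1{\mathcal A_{\rm s}}\int_0^\infty\exp\Big(-\sum_{\mathcal G}\int_{l_1}^\infty\Big(1-\frac1{1+\frac{\tau_1\mathcal G\,l_1}{G_{\rm s}G_{\rm u}z}}\Big)p_{\mathcal G}\lambda_{{\rm a}_{\rm s}}(z)\,dz-\frac{\tau_1{\tt N}_0Wl_1}{P_{\rm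 s}\beta_{{\rm a}_{\rm s}}G_{\rm s}G_{\rm u}}-\sum_{j\in\{{\rm m},{\rm s}\}}\Lambda_{{\rm a}_j}((0,\Omega_{j,{\rm s}}l_1])\Big)\lambda_{{\rm a}_{\rm s}}(l_1)\,dl_1,$$ $$\mathbb P({\tt SNR}_{\rm b}({\bf 0})>\tau_2)=\int_0^\infty\exp\Big(-\frac{\tau_2{\tt N}_0Wl_2}{P_{\rm m}\beta_{{\rm b}_{\rm m}}G_{\rm m}G_{\rm s}}-\Lambda_{{\rm b}_{\rm m}}((0,l_2])\Big)\lambda_{{\rm b}_{\rm m}}(l_2)\,dl_2 .$$ Consequently, under the independence assumption $$\mathbb P({\tt SINR}_{\rm a}({\bf 0})>\tau_1,\,{\tt SNR}_{\rm b}({\bf x}^*)>\tau_2\mid{\bf x}^*\in\Phi_{\rm s})=\mathbb P({\tt SINR}_{\rm a}({\bf 0})>\tau_1\mid{\bf x}^*\in\Phi_{\rm s})\,\mathbb P({\tt SNR}_{\rm b}({\bf 0})>\tau_2),$$ the joint SBS and backhaul coverage on the left is the product of the two right-hand sides displayed above. -/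

import Mathlib

open MeasureTheory ProbabilityTheory
open scoped ENNReal NNReal

noncomputable section

namespace IAB

/-- The plane with the Euclidean norm and Lebesgue measure. -/
abbrev Plane : Type := EuclideanSpace ℝ (Fin 2)

/-- The counting measure of the random sequence of points `X` at the outcome `ω`. -/
def counting {Ω : Type*} (X : ℕ → Ω → Plane) (ω : Ω) : Measure Plane :=
  Measure.sum fun n => Measure.dirac (X n ω)

/-- The points `X 0, X 1, …` form a homogeneous Poisson point process of density `lam > 0` in the
plane (which almost surely has infinitely many points). -/
structure IsPoissonProcess {Ω : Type*} [MeasurableSpace Ω] (P : Measure Ω)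
    (X : ℕ → Ω → Plane) (lam : ℝ) : Prop where
  measurable : ∀ n, Measurable (X n)
  count_law : ∀ A : Set Plane, MeasurableSet A → volume A ≠ ∞ →
    HasLaw (fun ω => counting X ω A)
      ((poissonMeasure (Real.toNNReal lam * (volume A).toNNReal)).map
        (Nat.cast : ℕ → ℝ≥0∞)) P
  count_indep : ∀ (k : ℕ) (A : Fin k → Set Plane), (∀ i, MeasurableSet (A i)) →
    (∀ i, volume (A i) ≠ ∞) → (∀ i j, i ≠ j → Disjoint (A i) (A j)) →
    iIndepFun (fun i ω => counting X ω (A i)) P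

/-- The two tiers: macro base stations (MBS) and small-cell base stations (SBS). -/
inductive Tier
  | mbs
  | sbs

instance : Inhabited Tier := ⟨.mbs⟩

/-- The state of a link: line of sight or not. -/
inductive LinkState
  | los
  | nlos

/-- The numerical parameters of the network. -/
structure Params where
  /-- densities of the two point processes -/
  dens : Tier → ℝ
  /-- transmit powers -/
  pow : Tier → ℝ
  /-- association bias factors -/
  bias : Tier → ℝ
  /-- propagation loss factor of an access link at the reference distance -/
  betaA : Tier → ℝ
  /-- propagation loss factor of an MBS-SBS backhaul link at the reference distance -/
  betaB : ℝ
  /-- pathloss exponents of access links -/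
  alphaA : Tier → LinkState → ℝ
  /-- pathloss exponents of MBS-SBS backhaul links -/
  alphaB : LinkState → ℝ
  /-- main-lobe antenna gains of the base stations -/
  gain : Tier → ℝ
  /-- side-lobe antenna gain of an SBS -/
  sideS : ℝ
  /-- main-lobe antenna gain of a UE -/
  gainU : ℝ
  /-- side-lobe antenna gain of a UE -/
  sideU : ℝ
  /-- beamwidth of an SBS -/
  thetaS : ℝ
  /-- beamwidth of a UE -/
  thetaU : ℝ
  /-- line-of-sight range constant -/
  mu : ℝ
  /-- noise power spectral density -/
  noise : ℝ
  /-- bandwidth -/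
  bw : ℝ
  dens_pos : ∀ i, 0 < dens i
  pow_pos : ∀ i, 0 < pow i
  bias_pos : ∀ i, 0 < bias i
  betaA_pos : ∀ i, 0 < betaA i
  betaB_pos : 0 < betaB
  alphaA_pos : ∀ i t, 0 < alphaA i t
  alphaB_pos : ∀ t, 0 < alphaB t
  gain_pos : ∀ i, 0 < gain i
  sideS_nonneg : 0 ≤ sideS
  gainU_pos : 0 < gainU
  sideU_nonneg : 0 ≤ sideU
  thetaS_mem : thetaS ∈ Set.Icc 0 (2 * Real.pi)
  thetaU_mem : thetaU ∈ Set.Icc 0 (2 * Real.pi)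
  mu_pos : 0 < mu
  noise_pos : 0 < noise
  bw_pos : 0 < bw

namespace Params

variable (p : Params)

/-- The effective gains of an interfering SBS access link; `true` stands for a main lobe and `false`
for a side lobe, first at the SBS and then at the UE. -/
def gainVal : Bool × Bool → ℝ := fun b =>
  (if b.1 then p.gain .sbs else p.sideS) * (if b.2 then p.gainU else p.sideU)

/-- The probability of each effective gain, for independent uniform beam directions. -/
def gainProb : Bool × Bool → ℝ := fun b =>
  (if b.1 then p.thetaS / (2 * Real.pi) else (2 * Real.pi - p.thetaS) / (2 * Real.pi)) *
    (if b.2 then p.thetaU / (2 * Real.pi) else (2 * Real.pi - p.thetaU) / (2 * Real.pi))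

/-- The law of the effective gain of an interfering SBS access link. -/
def gainLaw : Measure ℝ :=
  ∑ b : Bool × Bool, ENNReal.ofReal (p.gainProb b) • Measure.dirac (p.gainVal b)

end Params

/-- The labels of the scalar marks carried by the links. The receiving end of a backhaul link is
`some n` for the `n`-th SBS and `none` for the typical SBS, which sits at the origin. -/
inductive Mark
  | accessBlock (i : Tier) (n : ℕ)
  | accessFading (i : Tier) (n : ℕ)
  | accessGain (n : ℕ)
  | backhaulBlock (y : Option ℕ) (m : ℕ)
  | backhaulFading (y : Option ℕ) (m : ℕ)

/-- The laws of the marks: blocking variables are uniform on `[0, 1]`, fadings are exponential with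
mean `1`, and the gains of interfering SBSs have law `gainLaw`. -/
def Mark.law (p : Params) : Mark → Measure ℝ
  | .accessBlock _ _ => volume.restrict (Set.Icc 0 1)
  | .accessFading _ _ => expMeasure 1
  | .accessGain _ => p.gainLaw
  | .backhaulBlock _ _ => volume.restrict (Set.Icc 0 1)
  | .backhaulFading _ _ => expMeasure 1

/-- A realization on `(Ω, P)` of the two-tier network seen by the typical UE at the origin: two
independent homogeneous Poisson processes `pts .mbs` and `pts .sbs`, and mutually independent marks
on all links, independent of the two processes. -/
structure Network (p : Params) {Ω : Type*} [MeasurableSpace Ω] (P : Measure Ω) where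
  /-- the locations of the base stations -/
  pts : Tier → ℕ → Ω → Plane
  /-- the marks of the links -/
  mark : Mark → Ω → ℝ
  poisson : ∀ i, IsPoissonProcess P (pts i) (p.dens i)
  mark_measurable : ∀ k, Measurable (mark k)
  mark_law : ∀ k, HasLaw (mark k) (k.law p) P
  pts_indep : IndepFun (fun ω n => pts .mbs n ω) (fun ω n => pts .sbs n ω) P
  mark_indep : iIndepFun mark P
  pts_mark_indep : IndepFun (fun ω (i : Tier × ℕ) => pts i.1 i.2 ω) (fun ω k => mark k ω) P

/-- The state of a link of length `r` whose blocking variable is `u`: for `u` uniform on `[0, 1]` it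
is in line of sight with probability `exp (-r / mu)`. -/
def linkState (mu u r : ℝ) : LinkState :=
  open Classical in if u < Real.exp (-r / mu) then .los else .nlos

/-- The pathloss `r ^ α` of a link of length `r`, the exponent depending on the link state. -/
def pathloss (alpha : LinkState → ℝ) (mu u r : ℝ) : ℝ :=
  r ^ alpha (linkState mu u r)

namespace Network

variable {p : Params} {Ω : Type*} [MeasurableSpace Ω] {P : Measure Ω} (N : Network p P)

/-- The pathloss of the access link between the typical UE and base station `x`. -/
def lossA (x : Tier × ℕ) (ω : Ω) : ℝ :=
  pathloss (p.alphaA x.1) p.mu (N.mark (.accessBlock x.1 x.2) ω) ‖N.pts x.1 x.2 ω‖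

/-- The biased average power that the typical UE receives from base station `x`. -/
def biasedPower (x : Tier × ℕ) (ω : Ω) : ℝ :=
  p.pow x.1 * p.bias x.1 * p.betaA x.1 * p.gain x.1 * p.gainU * (N.lossA x ω)⁻¹

/-- The base station serving the typical UE: an `arg max` of the biased average received power
(almost surely it exists and is unique). -/
def serving (ω : Ω) : Tier × ℕ :=
  Classical.epsilon fun x => ∀ y, N.biasedPower y ω ≤ N.biasedPower x ω

/-- The event that the typical UE is served by tier `i`. -/
def assocEvent (i : Tier) : Set Ω := {ω | (N.serving ω).1 = i}

/-- The association probability of tier `i`. -/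
def assocProb (i : Tier) : ℝ≥0∞ := P (N.assocEvent i)

/-- The interference at the typical UE from all SBSs other than the serving base station; for some
pathloss exponents it is infinite. -/
def interference (ω : Ω) : ℝ≥0∞ :=
  open Classical in
  ∑' n : ℕ, if N.serving ω = (.sbs, n) then 0 else
    ENNReal.ofReal (p.pow .sbs * N.mark (.accessFading .sbs n) ω * p.betaA .sbs *
      N.mark (.accessGain n) ω * (N.lossA (.sbs, n) ω)⁻¹)

/-- The SINR of the typical access link, with the interference from MBSs neglected. -/
def sinrA (ω : Ω) : ℝ≥0∞ :=
  let x := N.serving ω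
  ENNReal.ofReal (p.pow x.1 * p.gain x.1 * p.gainU * p.betaA x.1 *
      N.mark (.accessFading x.1 x.2) ω * (N.lossA x ω)⁻¹) /
    (N.interference ω + ENNReal.ofReal (p.noise * p.bw))

/-- The location of an SBS: the `n`-th one for `some n`, the origin for the typical one. -/
def posS (y : Option ℕ) (ω : Ω) : Plane :=
  match y with
  | some n => N.pts .sbs n ω
  | none => 0

/-- The pathloss of the backhaul link between SBS `y` and the `m`-th MBS. -/
def lossB (y : Option ℕ) (m : ℕ) (ω : Ω) : ℝ :=
  pathloss p.alphaB p.mu (N.mark (.backhaulBlock y m) ω) ‖N.pts .mbs m ω - N.posS y ω‖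

/-- The average power that SBS `y` receives from the `m`-th MBS. -/
def powerB (y : Option ℕ) (m : ℕ) (ω : Ω) : ℝ :=
  p.pow .mbs * p.betaB * p.gain .mbs * p.gain .sbs * (N.lossB y m ω)⁻¹

/-- The anchor MBS of SBS `y`: an `arg max` of the average received power. -/
def anchor (y : Option ℕ) (ω : Ω) : ℕ :=
  Classical.epsilon fun m => ∀ k, N.powerB y k ω ≤ N.powerB y m ω

/-- The SNR of the backhaul link of SBS `y`. -/
def snrB (y : Option ℕ) (ω : Ω) : ℝ :=
  p.pow .mbs * p.gain .mbs * p.gain .sbs * p.betaB *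
    N.mark (.backhaulFading y (N.anchor y ω)) ω * (N.lossB y (N.anchor y ω) ω)⁻¹ /
      (p.noise * p.bw)

/-- The SNR of the typical backhaul link. -/
def snrTypical (ω : Ω) : ℝ := N.snrB none ω

/-- The SNR of the tagged backhaul link, that of the serving SBS (meaningful only on
`assocEvent .sbs`). -/
def snrTagged (ω : Ω) : ℝ := N.snrB (some (N.serving ω).2) ω

/-- The SBS access coverage, conditional on the typical UE being served by an SBS. -/
def accessCoverage (τ : ℝ) : ℝ≥0∞ :=
  P[{ω | ENNReal.ofReal τ < N.sinrA ω} | N.assocEvent .sbs]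

/-- The SNR coverage of the typical backhaul link. -/
def backhaulCoverage (τ : ℝ) : ℝ≥0∞ := P {ω | τ < N.snrTypical ω}

/-- The joint SBS and backhaul coverage, conditional on the typical UE being served by an SBS. -/
def jointCoverage (τ₁ τ₂ : ℝ) : ℝ≥0∞ :=
  P[{ω | ENNReal.ofReal τ₁ < N.sinrA ω ∧ τ₂ < N.snrTagged ω} | N.assocEvent .sbs]

end Network

/-- The intensity measure of `(0, l]` for the pathloss process of a Poisson process of density
`lam`. -/
def lossMeasure (lam mu : ℝ) (alpha : LinkState → ℝ) (l : ℝ) : ℝ :=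
  2 * Real.pi * lam *
    (mu * (mu - Real.exp (-l ^ (1 / alpha .los) / mu) * (l ^ (1 / alpha .los) + mu)) +
      l ^ (2 / alpha .nlos) / 2 -
      mu * (mu - Real.exp (-l ^ (1 / alpha .nlos) / mu) * (l ^ (1 / alpha .nlos) + mu)))

/-- The density of the same pathloss process at `l > 0`. -/
def lossDensity (lam mu : ℝ) (alpha : LinkState → ℝ) (l : ℝ) : ℝ :=
  2 * Real.pi * lam *
    (1 / alpha .los * l ^ (2 / alpha .los - 1) * Real.exp (-l ^ (1 / alpha .los) / mu) +
      1 / alpha .nlos * l ^ (2 / alpha .nlos - 1) *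
        (1 - Real.exp (-l ^ (1 / alpha .nlos) / mu)))

namespace Params

variable (p : Params)

/-- Intensity measure of `(0, l]` for the access pathloss process of tier `i`. -/
def LamA (i : Tier) (l : ℝ) : ℝ := lossMeasure (p.dens i) p.mu (p.alphaA i) l

/-- Density of the access pathloss process of tier `i`. -/
def lamA (i : Tier) (l : ℝ) : ℝ := lossDensity (p.dens i) p.mu (p.alphaA i) l

/-- Intensity measure of `(0, l]` for the pathloss process of the typical backhaul link. -/
def LamB (l : ℝ) : ℝ := lossMeasure (p.dens .mbs) p.mu p.alphaB l

/-- Density of the pathloss process of the typical backhaul link. -/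
def lamB (l : ℝ) : ℝ := lossDensity (p.dens .mbs) p.mu p.alphaB l

/-- The ratio of the biased powers of the tiers `j` and `i` at equal pathloss. -/
def Omega (j i : Tier) : ℝ :=
  (p.pow j * p.bias j * p.betaA j * p.gain j) / (p.pow i * p.bias i * p.betaA i * p.gain i)

/-- The exponent contributed by the SBS interference, a value in `[0, ∞]`. -/
def interferenceExponent (τ l : ℝ) : ℝ≥0∞ :=
  ∑ b : Bool × Bool, ∫⁻ z in Set.Ioi l, ENNReal.ofReal
    ((1 - 1 / (1 + τ * p.gainVal b * l / (p.gain .sbs * p.gainU * z))) *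
      p.gainProb b * p.lamA .sbs z)

/-- The integral over the pathloss of the serving SBS in the access coverage. -/
def accessIntegral (τ : ℝ) : ℝ≥0∞ :=
  ∫⁻ l in Set.Ioi (0 : ℝ),
    EReal.exp (-(p.interferenceExponent τ l : EReal)
        + ((-(τ * p.noise * p.bw * l / (p.pow .sbs * p.betaA .sbs * p.gain .sbs * p.gainU))
          - (p.LamA .mbs (p.Omega .mbs .sbs * l) + p.LamA .sbs (p.Omega .sbs .sbs * l)) : ℝ) :
            EReal))
      * ENNReal.ofReal (p.lamA .sbs l)

/-- The integral over the pathloss of the anchor MBS in the backhaul coverage. -/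
def backhaulIntegral (τ : ℝ) : ℝ≥0∞ :=
  ∫⁻ l in Set.Ioi (0 : ℝ), ENNReal.ofReal
    (Real.exp (-(τ * p.noise * p.bw * l / (p.pow .mbs * p.betaB * p.gain .mbs * p.gain .sbs))
      - p.LamB l) * p.lamB l)

end Params

end IAB

end

noncomputable section

namespace IAB

open Filter Topology Set

/-! Each tier, seen from the origin, yields a Poisson process of pathlosses on `(0, ∞)` with
intensity `lossIntensity` (only the intensity formula `lintegral_avgLoss` is needed). Up to ties,
the `n`-th SBS, of pathloss `l`, serves the UE with SINR above `τ₁` when the other SBSs have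
pathloss at least `l`, the MBSs have pathloss at least `Ω * l`, and its fading exceeds a constant
times `l * (interference + noise)`. An exponential fading exceeds an independent `S` with
probability equal to the mean of `e ^ (-S)`, and a hard constraint can be put into `S` as a summand
`0` or `∞`. Given the positions, the probability is therefore a product over links, hence the
exponential of a sum over points (`IsMarkField.measure_raceCond`). Working in `[0, ∞]` with `e ^
(-∞) = 0` covers infinite interference as well.

The enumeration of the points is arbitrary, so only sums over `n` have a known value. The Laplace
functional (`IsPoissonProcess.laplace`) follows from the laws of counts in disjoint sets;
differentiating it gives a Campbell formula, and reweighting by `e ^ u` turns that into a Mecke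
formula, in which the chosen point is removed from the exponential sum
(`IsPoissonProcess.sum_expNeg_others`). Together they give `sum_measure_raceCond`.

The level `l` in these conditions is itself random. `RaceCond` replaces it by a constant `c`: the
event implies the condition at every level up to the pathloss, and is implied by the condition at
any level strictly above it. `measure_eq_lintegral_of_levels` rounds the pathloss down and up to a
grid and refines the grid, which squeezes the probability onto the integral over `l`.

The backhaul formula is the same statement with the MBSs as competitors, no interference, and a
vacuous constraint on the other process. The joint formula then follows by substitution into the
assumed factorization. -/

/-! ### The exponential `e ^ (-x)` on `[0, ∞]` -/

/-- The function `x ↦ e ^ (-x)` on `[0, ∞]`, with `e ^ (-∞) = 0`. -/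
def expNeg (x : ℝ≥0∞) : ℝ≥0∞ := EReal.exp (-(x : EReal))

@[simp] lemma expNeg_zero : expNeg 0 = 1 := by simp [expNeg]

@[simp] lemma expNeg_top : expNeg ∞ = 0 := by simp [expNeg]

lemma expNeg_add (x y : ℝ≥0∞) : expNeg (x + y) = expNeg x * expNeg y := by
  rw [expNeg, expNeg, expNeg, ← EReal.exp_add, EReal.coe_ennreal_add, EReal.neg_add, sub_eq_add_neg]
  · exact Or.inl (by simp)
  · exact Or.inr (by simp)

lemma antitone_expNeg : Antitone expNeg := fun x y h => by
  simpa [expNeg] using h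

lemma expNeg_le_one (x : ℝ≥0∞) : expNeg x ≤ 1 := by
  simpa using antitone_expNeg (zero_le (a := x))

lemma expNeg_ne_top (x : ℝ≥0∞) : expNeg x ≠ ∞ :=
  ((expNeg_le_one x).trans_lt ENNReal.one_lt_top).ne

lemma continuous_expNeg : Continuous expNeg :=
  ENNReal.continuous_exp.comp (continuous_neg.comp continuous_coe_ennreal_ereal)

lemma measurable_expNeg : Measurable expNeg := continuous_expNeg.measurable

lemma expNeg_ofReal {x : ℝ} (hx : 0 ≤ x) :
    expNeg (ENNReal.ofReal x) = ENNReal.ofReal (Real.exp (-x)) := by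
  rw [expNeg, EReal.coe_ennreal_ofReal, max_eq_left hx, ← EReal.coe_neg, EReal.exp_coe]

lemma expNeg_ne_zero {x : ℝ≥0∞} (hx : x ≠ ∞) : expNeg x ≠ 0 := by
  simpa [expNeg] using hx

lemma expNeg_sum {ι : Type*} (s : Finset ι) (f : ι → ℝ≥0∞) :
    expNeg (∑ i ∈ s, f i) = ∏ i ∈ s, expNeg (f i) := by
  classical
  induction s using Finset.induction_on with
  | empty => simp
  | insert a s ha ih => rw [Finset.sum_insert ha, Finset.prod_insert ha, expNeg_add, ih]

lemma expNeg_natCast_mul (n : ℕ) (x : ℝ≥0∞) : expNeg (x * n) = expNeg x ^ n := by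
  induction n with
  | zero => simp
  | succ n ih => rw [Nat.cast_succ, mul_add, expNeg_add, ih, mul_one, pow_succ]

/-- The inverse of `expNeg` on `[0, 1]`. -/
def negLog (q : ℝ≥0∞) : ℝ≥0∞ := (-(ENNReal.log q)).toENNReal

lemma measurable_negLog : Measurable negLog :=
  (continuous_neg.measurable.comp ENNReal.measurable_log).ereal_toENNReal

lemma expNeg_negLog {q : ℝ≥0∞} (hq : q ≤ 1) : expNeg (negLog q) = q := by
  rw [expNeg, negLog, EReal.coe_toENNReal, neg_neg, ENNReal.exp_log]
  rw [← EReal.neg_le_neg_iff, neg_neg, neg_zero]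
  rw [← ENNReal.log_one]
  exact ENNReal.log_monotone hq

/-- This is the Poisson generating function: with `s = e ^ (-y)`, the series `∑ e ^ (-a) * (a * s) ^
n / n!` sums to `e ^ (-a * (1 - s))`. -/
lemma lintegral_expNeg_poissonMeasure (a : ℝ≥0) (y : ℝ≥0∞) :
    ∫⁻ n : ℕ, expNeg (y * n) ∂(poissonMeasure a) = expNeg (a * (1 - expNeg y)) := by
  obtain ⟨s, hs⟩ : ∃ s : ℝ≥0, expNeg y = s := ⟨_, (ENNReal.coe_toNNReal (expNeg_ne_top y)).symm⟩
  have hs1 : s ≤ 1 := by exact_mod_cast hs ▸ expNeg_le_one y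
  have hs1' : (s : ℝ) ≤ 1 := hs1
  rw [poissonMeasure, lintegral_sum_measure]
  simp only [lintegral_smul_measure, lintegral_dirac, expNeg_natCast_mul, hs, smul_eq_mul]
  have h1 : ((a : ℝ≥0∞) * (1 - s)) = ENNReal.ofReal (a * (1 - s)) := by
    rw [ENNReal.ofReal_mul a.coe_nonneg, ENNReal.ofReal_sub _ s.coe_nonneg]
    simp
  rw [h1, expNeg_ofReal (mul_nonneg a.coe_nonneg (by linarith))]
  have h2 : ∀ n : ℕ, ENNReal.ofReal (Real.exp (-(a : ℝ)) * (a : ℝ) ^ n / n.factorial) * (s : ℝ≥0∞) ^ n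
      = ENNReal.ofReal (Real.exp (-(a : ℝ)) * ((a * s : ℝ) ^ n / n.factorial)) := by
    intro n
    rw [← ENNReal.ofReal_coe_nnreal (p := s), ← ENNReal.ofReal_pow s.coe_nonneg, ← ENNReal.ofReal_mul (by positivity)]
    congr 1
    ring
  simp_rw [h2]
  have h3 : HasSum (fun n : ℕ => Real.exp (-(a : ℝ)) * ((a * s : ℝ) ^ n / n.factorial))
      (Real.exp (-(a : ℝ)) * Real.exp (a * s)) := by
    rw [Real.exp_eq_exp_ℝ]
    exact (NormedSpace.expSeries_div_hasSum_exp (a * s : ℝ)).mul_left _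
  rw [← ENNReal.ofReal_tsum_of_nonneg (fun n => by positivity) h3.summable, h3.tsum_eq, ← Real.exp_add]
  congr 2
  ring

/-! ### The Laplace functional of a Poisson process -/

variable {Ω : Type*} [MeasurableSpace Ω] {P : Measure Ω} {X : ℕ → Ω → Plane} {lam : ℝ}

omit [MeasurableSpace Ω] in
lemma lintegral_counting (X : ℕ → Ω → Plane) (ω : Ω) {u : Plane → ℝ≥0∞} (hu : Measurable u) :
    ∫⁻ x, u x ∂(counting X ω) = ∑' n, u (X n ω) := by
  simp [counting, lintegral_sum_measure, lintegral_dirac' _ hu]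

lemma IsPoissonProcess.lintegral_expNeg_mul_counting (hX : IsPoissonProcess P X lam)
    {A : Set Plane} (hA : MeasurableSet A) (hA' : volume A ≠ ∞) (y : ℝ≥0∞) :
    ∫⁻ ω, expNeg (y * counting X ω A) ∂P =
      expNeg (ENNReal.ofReal lam * volume A * (1 - expNeg y)) := by
  have hm : Measurable fun z : ℝ≥0∞ => expNeg (y * z) :=
    measurable_expNeg.comp (measurable_id.const_mul y)
  rw [(hX.count_law A hA hA').lintegral_comp hm.aemeasurable,
    lintegral_map hm (measurable_of_countable _), lintegral_expNeg_poissonMeasure]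
  simp [ENNReal.ofReal, ENNReal.coe_toNNReal hA']

lemma IsPoissonProcess.measurable_counting (hX : IsPoissonProcess P X lam)
    {A : Set Plane} (hA : MeasurableSet A) : Measurable fun ω => counting X ω A := by
  have h : (fun ω => counting X ω A) = fun ω => ∑' n, A.indicator 1 (X n ω) := by
    ext ω
    simp [counting, Measure.sum_apply _ hA, Measure.dirac_apply' _ hA]
  rw [h]
  exact Measurable.tsum fun n => (measurable_one.indicator hA).comp (hX.measurable n)

/-- The sum over the points is a finite combination of counts in the level sets of `s`. These sets
are disjoint, so the counts are independent and the expectation factors into Poisson generating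
functions. The level set of `0` may have infinite volume but contributes nothing. -/
lemma IsPoissonProcess.laplace_simpleFunc (hX : IsPoissonProcess P X lam)
    (s : SimpleFunc Plane ℝ≥0∞) (hs : ∀ y ≠ 0, volume (s ⁻¹' {y}) ≠ ∞) :
    ∫⁻ ω, expNeg (∑' n, s (X n ω)) ∂P =
      expNeg (ENNReal.ofReal lam * ∫⁻ x, (1 - expNeg (s x))) := by
  classical
  set t := s.range.filter (· ≠ 0) with ht
  -- One formula serves both sides: the counting measure with `f = id`, and Lebesgue measure with `f
  -- = 1 - expNeg`.
  have key : ∀ (μ : Measure Plane) (f : ℝ≥0∞ → ℝ≥0∞), f 0 = 0 →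
      ∫⁻ x, f (s x) ∂μ = ∑ i : Fin t.card, f (t.equivFin.symm i) *
        μ (s ⁻¹' {(t.equivFin.symm i : ℝ≥0∞)}) := by
    intro μ f hf
    have e1 : ∫⁻ x, f (s x) ∂μ = ∑ y ∈ s.range, f y * μ (s ⁻¹' {y}) := by
      rw [← SimpleFunc.map_lintegral, ← SimpleFunc.lintegral_eq_lintegral]
      rfl
    have e2 : ∑ y ∈ s.range, f y * μ (s ⁻¹' {y}) = ∑ y ∈ t, f y * μ (s ⁻¹' {y}) := by
      rw [ht, Finset.sum_filter_of_ne]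
      rintro y - hy rfl
      exact hy (by rw [hf, zero_mul])
    rw [e1, e2, ← Finset.sum_coe_sort, ← t.equivFin.symm.sum_comp]
  have h1 : ∀ ω, ∑' n, s (X n ω) = ∑ i : Fin t.card, (t.equivFin.symm i : ℝ≥0∞) *
      counting X ω (s ⁻¹' {(t.equivFin.symm i : ℝ≥0∞)}) := fun ω => by
    rw [← lintegral_counting X ω s.measurable]
    exact key _ id rfl
  have hne : ∀ i : Fin t.card, (t.equivFin.symm i : ℝ≥0∞) ≠ 0 := fun i =>
    (Finset.mem_filter.1 (t.equivFin.symm i).2).2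
  have hind := hX.count_indep t.card (fun i => s ⁻¹' {(t.equivFin.symm i : ℝ≥0∞)})
    (fun i => s.measurableSet_fiber _) (fun i => hs _ (hne i)) (fun i j hij => by
      refine Disjoint.preimage _ ?_
      simpa [Subtype.ext_iff] using fun h => hij (t.equivFin.symm.injective (Subtype.ext h)))
  simp_rw [h1, expNeg_sum]
  rw [lintegral_prod_eq_prod_lintegral_of_indepFun Finset.univ
    (fun i ω => expNeg ((t.equivFin.symm i : ℝ≥0∞) *
      counting X ω (s ⁻¹' {(t.equivFin.symm i : ℝ≥0∞)})))
    (hind.comp (fun i z => expNeg ((t.equivFin.symm i : ℝ≥0∞) * z))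
      fun i => measurable_expNeg.comp (measurable_id.const_mul _))
    (fun i => measurable_expNeg.comp ((hX.measurable_counting (s.measurableSet_fiber _)).const_mul _))]
  rw [key volume (fun y => 1 - expNeg y) (by simp), Finset.mul_sum, expNeg_sum]
  refine Finset.prod_congr rfl fun i _ => ?_
  rw [hX.lintegral_expNeg_mul_counting (s.measurableSet_fiber _) (hs _ (hne i))]
  congr 1
  ring

lemma tendsto_lintegral_of_monotone_of_iSup {α : Type*} [MeasurableSpace α] (μ : Measure α)
    {f : ℕ → α → ℝ≥0∞} {F : α → ℝ≥0∞} (hf : ∀ m, Measurable (f m)) (hmono : Monotone f)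
    (hF : ∀ x, ⨆ m, f m x = F x) :
    Tendsto (fun m => ∫⁻ x, f m x ∂μ) atTop (𝓝 (∫⁻ x, F x ∂μ)) := by
  refine lintegral_tendsto_of_tendsto_of_monotone (fun m => (hf m).aemeasurable)
    (.of_forall fun x _ _ h => hmono h x) (.of_forall fun x => ?_)
  rw [← hF x]
  exact tendsto_atTop_iSup fun _ _ h => hmono h x

/-- The Laplace functional of a homogeneous Poisson process. -/
theorem IsPoissonProcess.laplace [IsProbabilityMeasure P] (hX : IsPoissonProcess P X lam)
    {u : Plane → ℝ≥0∞} (hu : Measurable u) :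
    ∫⁻ ω, expNeg (∑' n, u (X n ω)) ∂P =
      expNeg (ENNReal.ofReal lam * ∫⁻ x, (1 - expNeg (u x))) := by
  -- Cutting off to balls gives the nonzero level sets finite volume, as the laws of the counts
  -- require.
  set s : ℕ → SimpleFunc Plane ℝ≥0∞ := fun m =>
    (SimpleFunc.eapprox u m).restrict (Metric.ball 0 m) with hs
  have hsv : ∀ m x, s m x = (Metric.ball (0 : Plane) m).indicator (SimpleFunc.eapprox u m) x :=
    fun m x => by rw [hs, SimpleFunc.restrict_apply _ Metric.isOpen_ball.measurableSet]
  have hmono : Monotone fun m x => s m x := by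
    intro m k hmk x
    simp only [hsv]
    refine (indicator_le_indicator_apply_of_subset (Metric.ball_subset_ball (by exact_mod_cast hmk))
      zero_le).trans (indicator_le_indicator ?_)
    exact SimpleFunc.monotone_eapprox u hmk x
  have hsup : ∀ x, ⨆ m, s m x = u x := by
    intro x
    refine le_antisymm (iSup_le fun m => ?_) ?_
    · rw [hsv, ← SimpleFunc.iSup_eapprox_apply hu x]
      exact (indicator_le_self' (fun _ _ => zero_le) x).trans
        (le_iSup (fun m => (SimpleFunc.eapprox u m) x) m)
    · rw [← SimpleFunc.iSup_eapprox_apply hu x]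
      refine iSup_le fun m => ?_
      obtain ⟨k, hk⟩ := exists_nat_gt ‖x‖
      refine le_iSup_of_le (max m k) ?_
      rw [hsv, indicator_of_mem]
      · exact SimpleFunc.monotone_eapprox u (le_max_left m k) x
      · rw [mem_ball_zero_iff]
        exact hk.trans_le (by exact_mod_cast le_max_right m k)
  have hfin : ∀ m, ∀ y ≠ 0, volume (s m ⁻¹' {y}) ≠ ∞ := by
    intro m y hy
    refine ((measure_mono ?_).trans_lt (measure_ball_lt_top (x := (0 : Plane)) (r := m))).ne
    intro x hx
    by_contra hxb
    have : s m x = y := hx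
    rw [hsv, indicator_of_notMem hxb] at this
    exact hy this.symm
  have hL : Tendsto (fun m => ∫⁻ ω, expNeg (∑' n, s m (X n ω)) ∂P) atTop
      (𝓝 (∫⁻ ω, expNeg (∑' n, u (X n ω)) ∂P)) := by
    refine tendsto_lintegral_of_dominated_convergence (fun _ => 1) (fun m => ?_)
      (fun m => .of_forall fun ω => expNeg_le_one _) (by simp) (.of_forall fun ω => ?_)
    · exact measurable_expNeg.comp
        (Measurable.tsum fun n => (s m).measurable.comp (hX.measurable n))
    · refine (continuous_expNeg.tendsto _).comp ?_
      simp_rw [← lintegral_counting X ω (s _).measurable, ← lintegral_counting X ω hu]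
      exact tendsto_lintegral_of_monotone_of_iSup _ (fun m => (s m).measurable) hmono hsup
  have hR : Tendsto (fun m => expNeg (ENNReal.ofReal lam * ∫⁻ x, (1 - expNeg (s m x)))) atTop
      (𝓝 (expNeg (ENNReal.ofReal lam * ∫⁻ x, (1 - expNeg (u x))))) := by
    refine ((continuous_expNeg.comp (ENNReal.continuous_const_mul ENNReal.ofReal_ne_top)).tendsto
      _).comp ?_
    refine lintegral_tendsto_of_tendsto_of_monotone
      (fun m => (measurable_const.sub (measurable_expNeg.comp (s m).measurable)).aemeasurable)
      (.of_forall fun x _ _ h => tsub_le_tsub_left (antitone_expNeg (hmono h x)) 1)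
      (.of_forall fun x => ?_)
    refine ENNReal.Tendsto.sub tendsto_const_nhds ((continuous_expNeg.tendsto _).comp ?_)
      (Or.inl ENNReal.one_ne_top)
    rw [← hsup x]
    exact tendsto_atTop_iSup fun _ _ h => hmono h x
  refine tendsto_nhds_unique hL (hR.congr fun m => ?_)
  rw [hX.laplace_simpleFunc (s m) (hfin m)]

/-! ### Campbell and Mecke formulas -/

/-- Difference quotients of `expNeg` at `0`, which increase to the identity. -/
def quot (m : ℕ) (x : ℝ≥0∞) : ℝ≥0∞ := 2 ^ m * (1 - expNeg (x / 2 ^ m))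

lemma measurable_quot (m : ℕ) : Measurable (quot m) :=
  (measurable_const.sub (measurable_expNeg.comp (measurable_id.div_const _))).const_mul _

lemma quot_mono_right (m : ℕ) : Monotone (quot m) := fun x y h => by
  unfold quot
  gcongr
  exact antitone_expNeg (by gcongr)

/-- With `y = e ^ (-x / 2 ^ (m + 1))`, one step amounts to `1 - y ^ 2 ≤ 2 * (1 - y)`, that is, `0 ≤
(1 - y) ^ 2`. -/
lemma quot_mono_left (x : ℝ≥0∞) : Monotone fun m => quot m x := by
  refine monotone_nat_of_le_succ fun m => ?_
  unfold quot
  have h : x / 2 ^ m = x / 2 ^ (m + 1) + x / 2 ^ (m + 1) := by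
    rw [← two_mul, pow_succ, div_eq_mul_inv, div_eq_mul_inv, ENNReal.mul_inv (by simp) (by simp),
      mul_left_comm, mul_comm 2, mul_assoc, ENNReal.inv_mul_cancel (by simp) (by simp), mul_one]
  rw [h, expNeg_add]
  generalize x / 2 ^ (m + 1) = z
  rw [pow_succ, mul_assoc]
  gcongr
  rw [ENNReal.mul_sub (by simp)]
  rw [tsub_le_iff_right, mul_one]
  have hy : expNeg z ≤ 1 := expNeg_le_one z
  have hy' : expNeg z ≠ ∞ := expNeg_ne_top z
  generalize expNeg z = y at *
  lift y to ℝ≥0 using hy'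
  have hy1 : y ≤ 1 := by exact_mod_cast hy
  have : (2 : ℝ≥0∞) - 2 * y = ((2 - 2 * y : ℝ≥0) : ℝ≥0∞) := by push_cast; rfl
  rw [this]
  norm_cast
  rw [← NNReal.coe_le_coe]
  push_cast [NNReal.coe_sub (show 2 * y ≤ 2 by nlinarith)]
  nlinarith [sq_nonneg ((y : ℝ) - 1)]

/-- For finite `x` the quotients are the slopes of `t ↦ 1 - e ^ (-x * t)` at `0` along `t = 2 ^
(-m)`; for `x = ∞` they are `2 ^ m`. -/
lemma iSup_quot (x : ℝ≥0∞) : ⨆ m, quot m x = x := by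
  refine tendsto_nhds_unique (tendsto_atTop_iSup (quot_mono_left x)) ?_
  by_cases hx : x = ∞
  · subst hx
    have : ∀ m, quot m ∞ = 2 ^ m := fun m => by
      rw [quot, ENNReal.top_div_of_ne_top (by simp)]
      simp
    simp_rw [this]
    exact ENNReal.tendsto_pow_atTop_nhds_top_iff.2 (by norm_num)
  · lift x to ℝ≥0 using hx
    have hq : ∀ m, quot m x = ENNReal.ofReal (((2 : ℝ)⁻¹ ^ m)⁻¹ * (1 - Real.exp (-(x * (2 : ℝ)⁻¹ ^ m)))) := by
      intro m
      have h1 : (x : ℝ≥0∞) / 2 ^ m = ENNReal.ofReal (x * (2 : ℝ)⁻¹ ^ m) := by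
        rw [ENNReal.ofReal_mul x.coe_nonneg, ENNReal.ofReal_pow (by norm_num),
          ENNReal.ofReal_inv_of_pos (by norm_num), div_eq_mul_inv, ENNReal.inv_pow]
        simp
      rw [quot, h1, expNeg_ofReal (by positivity), ENNReal.ofReal_mul (by positivity),
        ENNReal.ofReal_sub _ (Real.exp_nonneg _), ENNReal.ofReal_one, ← inv_pow, inv_inv,
        ENNReal.ofReal_pow (by norm_num)]
      simp
    simp_rw [hq]
    rw [← ENNReal.ofReal_coe_nnreal]
    refine (ENNReal.continuous_ofReal.tendsto _).comp ?_
    have hd : HasDerivAt (fun t : ℝ => 1 - Real.exp (-(x * t))) (x : ℝ) 0 := by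
      have := (((hasDerivAt_id (0 : ℝ)).const_mul (x : ℝ)).neg.exp).const_sub 1
      simpa using this
    have h2 := hasDerivAt_iff_tendsto_slope_zero.1 hd
    simp only [zero_add, mul_zero, neg_zero, Real.exp_zero, sub_self, sub_zero, smul_eq_mul] at h2
    refine h2.comp (tendsto_nhdsWithin_iff.2 ⟨?_, .of_forall fun m => ?_⟩)
    · exact tendsto_pow_atTop_nhds_zero_of_lt_one (by norm_num) (by norm_num)
    · simp

/-- A Campbell formula with an exponential weight. -/
theorem IsPoissonProcess.campbell_expNeg [IsProbabilityMeasure P] (hX : IsPoissonProcess P X lam)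
    {u g : Plane → ℝ≥0∞} (hu : Measurable u) (hg : Measurable g) :
    ∫⁻ ω, (∑' n, g (X n ω)) * expNeg (∑' n, u (X n ω)) ∂P =
      (ENNReal.ofReal lam * ∫⁻ x, g x * expNeg (u x)) *
        expNeg (ENNReal.ofReal lam * ∫⁻ x, (1 - expNeg (u x))) := by
  have hGm : ∀ {v : Plane → ℝ≥0∞}, Measurable v → Measurable fun ω => ∑' n, v (X n ω) :=
    fun hv => Measurable.tsum fun n => hv.comp (hX.measurable n)
  set K := expNeg (ENNReal.ofReal lam * ∫⁻ x, (1 - expNeg (u x))) with hK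
  set J : ℕ → ℝ≥0∞ := fun m => ENNReal.ofReal lam * ∫⁻ x, quot m (g x) * expNeg (u x) with hJ
  have hJmono : Monotone J := fun m k h => by
    simp only [hJ]
    gcongr
    exact quot_mono_left _ h
  have hJsup : ⨆ m, J m = ENNReal.ofReal lam * ∫⁻ x, g x * expNeg (u x) := by
    rw [hJ, ← ENNReal.mul_iSup, ← lintegral_iSup]
    · simp_rw [← ENNReal.iSup_mul, iSup_quot]
    · exact fun m => ((measurable_quot m).comp hg).mul (measurable_expNeg.comp hu)
    · exact fun m k h x => mul_le_mul_left (quot_mono_left _ h) _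
  -- The product is `2 ^ m` times the difference of two Laplace functionals, for `u` and for `u + g
  -- / 2 ^ m`. The exponent of the second exceeds that of the first by `J m / 2 ^ m`, which
  -- reproduces `quot m`.
  have hstep : ∀ m, ∫⁻ ω, quot m (∑' n, g (X n ω)) * expNeg (∑' n, u (X n ω)) ∂P
      = quot m (J m) * K := by
    intro m
    have hg' : Measurable fun x => g x / 2 ^ m := hg.div_const _
    have h1 : ∀ ω, quot m (∑' n, g (X n ω)) * expNeg (∑' n, u (X n ω)) =
        2 ^ m * (expNeg (∑' n, u (X n ω)) - expNeg (∑' n, (u (X n ω) + g (X n ω) / 2 ^ m))) := by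
      intro ω
      rw [quot, mul_assoc, ENNReal.sub_mul (fun _ _ => expNeg_ne_top _), one_mul,
        ENNReal.tsum_add, expNeg_add, mul_comm (expNeg (∑' n, u (X n ω)))]
      simp_rw [div_eq_mul_inv, ENNReal.tsum_mul_right]
    have h2 : ENNReal.ofReal lam * ∫⁻ x, (1 - expNeg (u x + g x / 2 ^ m)) =
        ENNReal.ofReal lam * (∫⁻ x, (1 - expNeg (u x))) + J m / 2 ^ m := by
      rw [hJ, div_eq_mul_inv, mul_assoc, ← mul_add, ← lintegral_mul_const' _ _ (by simp),
        ← lintegral_add_left (f := fun x => 1 - expNeg (u x))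
          (measurable_const.sub (measurable_expNeg.comp hu))]
      congr 1
      refine lintegral_congr fun x => ?_
      rw [expNeg_add, quot, mul_assoc, mul_assoc, mul_comm (2 ^ m), mul_assoc, mul_assoc,
        ENNReal.inv_mul_cancel (by simp) (by simp), mul_one]
      have ha := expNeg_le_one (u x)
      have hb := expNeg_le_one (g x / 2 ^ m)
      generalize expNeg (u x) = a at *
      generalize expNeg (g x / 2 ^ m) = b at *
      rw [ENNReal.sub_mul (fun _ _ => (ha.trans_lt ENNReal.one_lt_top).ne), one_mul, mul_comm b]
      have hab : a * b ≤ a := mul_le_of_le_one_right' hb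
      rw [tsub_add_tsub_cancel ha hab]
    simp_rw [h1]
    rw [lintegral_const_mul' _ _ (by simp), lintegral_sub]
    · rw [hX.laplace hu, hX.laplace (u := fun x => u x + g x / 2 ^ m) (hu.add hg'), h2, expNeg_add, ← hK, quot, mul_assoc,
        ENNReal.sub_mul (fun _ _ => expNeg_ne_top _), one_mul, mul_comm K]
    · exact measurable_expNeg.comp (hGm (hu.add hg'))
    · exact ((lintegral_mono fun _ => expNeg_le_one _).trans_lt (by simp)).ne
    · exact .of_forall fun ω => antitone_expNeg (ENNReal.tsum_le_tsum fun n => le_self_add)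
  calc ∫⁻ ω, (∑' n, g (X n ω)) * expNeg (∑' n, u (X n ω)) ∂P
      = ⨆ m, ∫⁻ ω, quot m (∑' n, g (X n ω)) * expNeg (∑' n, u (X n ω)) ∂P := by
        rw [← lintegral_iSup]
        · simp_rw [← ENNReal.iSup_mul, iSup_quot]
        · exact fun m => ((measurable_quot m).comp (hGm hg)).mul (measurable_expNeg.comp (hGm hu))
        · exact fun m k h x => mul_le_mul_left (quot_mono_left _ h) _
    _ = (⨆ m, quot m (J m)) * K := by simp_rw [hstep, ENNReal.iSup_mul]
    _ = (⨆ m, J m) * K := by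
        congr 1
        -- Both `quot` and `J` increase with `m`, so the diagonal supremum equals the iterated one.
        refine le_antisymm (iSup_mono fun m => ?_) (iSup_le fun k => ?_)
        · exact (le_iSup (fun i => quot i (J m)) m).trans_eq (iSup_quot _)
        · rw [← iSup_quot (J k)]
          refine iSup_le fun m => ?_
          exact le_iSup_of_le (max m k) ((quot_mono_left _ (le_max_left m k)).trans
            (quot_mono_right _ (hJmono (le_max_right m k))))
    _ = _ := by rw [hJsup]

/-- The sum of the values of `f` at all indices other than `n`. -/
def sumExcept (n : ℕ) (f : ℕ → ℝ≥0∞) : ℝ≥0∞ := ∑' k, if k = n then 0 else f k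

lemma add_sumExcept (n : ℕ) (f : ℕ → ℝ≥0∞) : f n + sumExcept n f = ∑' k, f k := by
  rw [ENNReal.tsum_eq_add_tsum_ite (f := f) n, sumExcept]
  congr!

lemma measurable_sumExcept (n : ℕ) {α : Type*} [MeasurableSpace α] {f : ℕ → α → ℝ≥0∞}
    (hf : ∀ k, Measurable (f k)) : Measurable fun a => sumExcept n fun k => f k a := by
  refine Measurable.tsum fun k => ?_
  split_ifs
  · exact measurable_const
  · exact hf k

lemma tendsto_sumExcept (n : ℕ) {f : ℕ → ℕ → ℝ≥0∞} {F : ℕ → ℝ≥0∞} (hf : ∀ k, Monotone fun m => f m k)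
    (hF : ∀ k, Tendsto (fun m => f m k) atTop (𝓝 (F k))) :
    Tendsto (fun m => sumExcept n (f m)) atTop (𝓝 (sumExcept n F)) := by
  simp_rw [sumExcept, ← lintegral_count]
  refine lintegral_tendsto_of_tendsto_of_monotone (fun M => (measurable_of_countable _).aemeasurable)
    (.of_forall fun k M M' h => ?_) (.of_forall fun k => ?_)
  · dsimp only
    split_ifs
    · exact le_rfl
    · exact hf k h
  · split_ifs
    · exact tendsto_const_nhds
    · exact hF k

/-- Removing the point `n` from the exponential sum is the same as multiplying its weight `g` by `e
^ u`, so this is the Campbell formula for `g * e ^ u`. The cancellation needs `u` finite. -/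
lemma IsPoissonProcess.sum_expNeg_others_of_ne_top [IsProbabilityMeasure P]
    (hX : IsPoissonProcess P X lam) {u g : Plane → ℝ≥0∞} (hu : Measurable u) (hg : Measurable g)
    (hfin : ∀ x, u x ≠ ∞) :
    ∑' n, ∫⁻ ω, g (X n ω) * expNeg (sumExcept n fun k => u (X k ω)) ∂P =
      (ENNReal.ofReal lam * ∫⁻ x, g x) *
        expNeg (ENNReal.ofReal lam * ∫⁻ x, (1 - expNeg (u x))) := by
  have hm : ∀ n, Measurable fun ω => g (X n ω) * expNeg (sumExcept n fun k => u (X k ω)) := by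
    intro n
    refine (hg.comp (hX.measurable n)).mul (measurable_expNeg.comp
      (measurable_sumExcept n fun k => hu.comp (hX.measurable k)))
  have hc : ∀ x, g x * (expNeg (u x))⁻¹ * expNeg (u x) = g x := fun x => by
    rw [mul_assoc, ENNReal.inv_mul_cancel (expNeg_ne_zero (hfin x)) (expNeg_ne_top _), mul_one]
  rw [← lintegral_tsum fun n => (hm n).aemeasurable]
  have := hX.campbell_expNeg hu (hg.mul (measurable_expNeg.comp hu).inv)
  simp only [Pi.mul_apply, Pi.inv_apply, Function.comp_apply, hc] at this
  rw [← this]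
  refine lintegral_congr fun ω => ?_
  rw [← ENNReal.tsum_mul_right]
  refine tsum_congr fun n => ?_
  rw [← add_sumExcept n, expNeg_add, ← mul_assoc, hc]

/-- The sum over the points of a Poisson process of an exponential functional of the remaining
points. -/
theorem IsPoissonProcess.sum_expNeg_others [IsProbabilityMeasure P]
    (hX : IsPoissonProcess P X lam) {u g : Plane → ℝ≥0∞} (hu : Measurable u) (hg : Measurable g)
    (hgi : ∫⁻ x, g x ≠ ∞) :
    ∑' n, ∫⁻ ω, g (X n ω) * expNeg (sumExcept n fun k => u (X k ω)) ∂P =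
      (ENNReal.ofReal lam * ∫⁻ x, g x) *
        expNeg (ENNReal.ofReal lam * ∫⁻ x, (1 - expNeg (u x))) := by
  -- The value `u = ∞` encodes a forbidden region, where `e ^ u` cannot be cancelled; hence the
  -- truncation of `u` at `M`, with `M → ∞`.
  have hmin : ∀ y : ℝ≥0∞, Tendsto (fun M : ℕ => min y M) atTop (𝓝 y) := fun y => by
    simpa using (tendsto_const_nhds (x := y)).min ENNReal.tendsto_nat_nhds_top
  have hminmono : ∀ y : ℝ≥0∞, Monotone fun M : ℕ => min y M := fun y m k h =>
    min_le_min le_rfl (by exact_mod_cast h)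
  have hum : ∀ M : ℕ, Measurable fun x => min (u x) M := fun M => hu.min measurable_const
  -- The case `u = 0` of the truncated formula shows that the terms without exponential factor are
  -- summable, which gives the dominating function for both limits.
  have htot : ∑' n, ∫⁻ ω, g (X n ω) ∂P ≠ ∞ := by
    have := hX.sum_expNeg_others_of_ne_top (u := fun _ => 0) measurable_const hg (by simp)
    simp only [sumExcept, ite_self, tsum_zero, expNeg_zero, mul_one, tsub_self, lintegral_zero, mul_zero]
      at this
    rw [this]
    exact ENNReal.mul_ne_top ENNReal.ofReal_ne_top hgi
  have hm : ∀ {v : Plane → ℝ≥0∞}, Measurable v → ∀ n, Measurable fun ω =>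
      g (X n ω) * expNeg (sumExcept n fun k => v (X k ω)) := by
    intro v hv n
    refine (hg.comp (hX.measurable n)).mul (measurable_expNeg.comp
      (measurable_sumExcept n fun k => hv.comp (hX.measurable k)))
  have hle : ∀ (v : Plane → ℝ≥0∞) n ω,
      g (X n ω) * expNeg (sumExcept n fun k => v (X k ω)) ≤ g (X n ω) :=
    fun v n ω => mul_le_of_le_one_right' (expNeg_le_one _)
  have hterm : ∀ n, Tendsto
      (fun M : ℕ => ∫⁻ ω, g (X n ω) * expNeg (sumExcept n fun k => min (u (X k ω)) M) ∂P)
      atTop (𝓝 (∫⁻ ω, g (X n ω) * expNeg (sumExcept n fun k => u (X k ω)) ∂P)) := by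
    intro n
    refine tendsto_lintegral_of_dominated_convergence' (fun ω => g (X n ω))
      (fun M => (hm (hum M) n).aemeasurable) (fun M => .of_forall fun ω => hle (fun x => min (u x) M) n ω)
      (ENNReal.ne_top_of_tsum_ne_top htot n) ?_
    have hgf : ∀ᵐ ω ∂P, g (X n ω) < ∞ :=
      ae_lt_top (hg.comp (hX.measurable n)) (ENNReal.ne_top_of_tsum_ne_top htot n)
    filter_upwards [hgf] with ω hω
    refine ENNReal.Tendsto.const_mul ((continuous_expNeg.tendsto _).comp ?_) (Or.inr hω.ne)
    exact tendsto_sumExcept n (fun k => hminmono _) (fun k => hmin _)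
  have hL : Tendsto (fun M : ℕ => ∑' n, ∫⁻ ω, g (X n ω) *
      expNeg (sumExcept n fun k => min (u (X k ω)) M) ∂P) atTop
      (𝓝 (∑' n, ∫⁻ ω, g (X n ω) * expNeg (sumExcept n fun k => u (X k ω)) ∂P)) := by
    simp_rw [← lintegral_count]
    refine tendsto_lintegral_of_dominated_convergence (fun n => ∫⁻ ω, g (X n ω) ∂P)
      (fun M => measurable_of_countable _)
      (fun M => .of_forall fun n => lintegral_mono fun ω =>
        hle (fun x => min (u x) M) n ω) ?_ (.of_forall hterm)
    rwa [lintegral_count]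
  refine tendsto_nhds_unique hL ?_
  simp_rw [fun M : ℕ => hX.sum_expNeg_others_of_ne_top (hum M) hg
    (fun x => ((min_le_right _ _).trans_lt (ENNReal.natCast_lt_top M)).ne)]
  refine ENNReal.Tendsto.const_mul ?_
    (Or.inr (ENNReal.mul_ne_top ENNReal.ofReal_ne_top hgi))
  refine ((continuous_expNeg.comp (ENNReal.continuous_const_mul ENNReal.ofReal_ne_top)).tendsto
      _).comp ?_
  refine lintegral_tendsto_of_tendsto_of_monotone
    (fun m => (measurable_const.sub (measurable_expNeg.comp (hum m))).aemeasurable)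
    (.of_forall fun x _ _ h => tsub_le_tsub_left (antitone_expNeg (hminmono _ h)) 1)
    (.of_forall fun x => ?_)
  exact ENNReal.Tendsto.sub tendsto_const_nhds ((continuous_expNeg.tendsto _).comp (hmin _))
    (Or.inl ENNReal.one_ne_top)

/-! ### The pathloss process and its intensity -/

lemma pathloss_eq (alpha : LinkState → ℝ) (mu u r : ℝ) :
    pathloss alpha mu u r =
      if u < Real.exp (-r / mu) then r ^ alpha .los else r ^ alpha .nlos := by
  unfold pathloss linkState
  split_ifs <;> rfl

lemma pathloss_nonneg (alpha : LinkState → ℝ) (mu u : ℝ) {r : ℝ} (hr : 0 ≤ r) :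
    0 ≤ pathloss alpha mu u r := Real.rpow_nonneg hr _

lemma pathloss_pos (alpha : LinkState → ℝ) (mu u : ℝ) {r : ℝ} (hr : 0 < r) :
    0 < pathloss alpha mu u r := Real.rpow_pos_of_pos hr _

lemma measurable_pathloss (alpha : LinkState → ℝ) (mu : ℝ) :
    Measurable fun z : ℝ × ℝ => pathloss alpha mu z.1 z.2 := by
  simp_rw [pathloss_eq]
  refine Measurable.ite (measurableSet_lt measurable_fst ?_) ?_ ?_ <;> fun_prop

/-- The expectation of `H` at the pathloss of a link of length `r`. -/
def avgLoss (alpha : LinkState → ℝ) (mu : ℝ) (H : ℝ → ℝ≥0∞) (r : ℝ) : ℝ≥0∞ :=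
  ∫⁻ u in Icc (0 : ℝ) 1, H (pathloss alpha mu u r)

lemma measurable_avgLoss (alpha : LinkState → ℝ) (mu : ℝ) {H : ℝ → ℝ≥0∞} (hH : Measurable H) :
    Measurable (avgLoss alpha mu H) :=
  (hH.comp (measurable_pathloss alpha mu)).lintegral_prod_left'

lemma avgLoss_le_one (alpha : LinkState → ℝ) (mu : ℝ) {H : ℝ → ℝ≥0∞} (hH : ∀ l, H l ≤ 1) (r : ℝ) :
    avgLoss alpha mu H r ≤ 1 :=
  (lintegral_mono fun u => hH _).trans (by simp)

lemma one_sub_avgLoss (alpha : LinkState → ℝ) (mu : ℝ) {H : ℝ → ℝ≥0∞} (hH : Measurable H)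
    (hH1 : ∀ l, H l ≤ 1) (r : ℝ) :
    1 - avgLoss alpha mu H r = avgLoss alpha mu (fun l => 1 - H l) r := by
  have hm : Measurable fun u => H (pathloss alpha mu u r) :=
    hH.comp ((measurable_pathloss alpha mu).comp (measurable_id.prodMk measurable_const))
  have h := avgLoss_le_one alpha mu hH1 r
  unfold avgLoss at h ⊢
  rw [lintegral_sub hm (h.trans_lt ENNReal.one_lt_top).ne (.of_forall fun u => hH1 _)]
  simp

/-- The uniform blocking variable splits `[0, 1]` at `e ^ (-r / mu)`, and the pathloss is constant
on each piece. -/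
lemma avgLoss_eq (alpha : LinkState → ℝ) {mu : ℝ} (hmu : 0 < mu) (H : ℝ → ℝ≥0∞) {r : ℝ}
    (hr : 0 ≤ r) :
    avgLoss alpha mu H r = ENNReal.ofReal (Real.exp (-r / mu)) * H (r ^ alpha .los) +
      ENNReal.ofReal (1 - Real.exp (-r / mu)) * H (r ^ alpha .nlos) := by
  set e := Real.exp (-r / mu) with he
  have he0 : 0 ≤ e := Real.exp_nonneg _
  have he1 : e ≤ 1 := Real.exp_le_one_iff.2 (div_nonpos_of_nonpos_of_nonneg (by linarith) hmu.le)
  have hs : Icc (0 : ℝ) 1 = Ico 0 e ∪ Icc e 1 := (Ico_union_Icc_eq_Icc he0 he1).symm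
  have hd : Disjoint (Ico (0 : ℝ) e) (Icc e 1) :=
    disjoint_left.2 fun x hx hx' => absurd hx.2 (not_lt.2 hx'.1)
  rw [avgLoss, hs, lintegral_union measurableSet_Icc hd]
  congr 1
  · rw [setLIntegral_congr_fun measurableSet_Ico
      (g := fun _ => H (r ^ alpha .los)) fun u hu => by
        rw [pathloss_eq, if_pos hu.2]]
    simp [mul_comm]
  · rw [setLIntegral_congr_fun measurableSet_Icc
      (g := fun _ => H (r ^ alpha .nlos)) fun u hu => by
        rw [pathloss_eq, if_neg (not_lt.2 hu.1)]]
    simp [mul_comm]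

/-- Polar coordinates: the sphere measure has total mass twice the area of the unit disc, and the
radial density is `r`. -/
lemma lintegral_norm_plane {f : ℝ → ℝ≥0∞} (hf : Measurable f) :
    ∫⁻ x : Plane, f ‖x‖ = ENNReal.ofReal (2 * Real.pi) *
      ∫⁻ r in Ioi (0 : ℝ), ENNReal.ofReal r * f r := by
  have hdim : Module.finrank ℝ Plane = 2 := by simp
  calc ∫⁻ x : Plane, f ‖x‖
      = ∫⁻ x : ({(0 : Plane)}ᶜ : Set Plane), f ‖x.1‖ ∂(volume.comap Subtype.val) := by
        rw [lintegral_subtype_comap (measurableSet_singleton _).compl fun x => f ‖x‖,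
          restrict_compl_singleton]
    _ = ∫⁻ x, f x.2 ∂(volume : Measure Plane).toSphere.prod (.volumeIoiPow (Module.finrank ℝ Plane - 1)) := by
        simpa using (volume : Measure Plane).measurePreserving_homeomorphUnitSphereProd.lintegral_comp_emb
          (Homeomorph.measurableEmbedding _) (f ∘ Subtype.val ∘ Prod.snd)
    _ = (volume : Measure Plane).toSphere univ *
          ∫⁻ r : Ioi (0 : ℝ), f r ∂.volumeIoiPow (Module.finrank ℝ Plane - 1) := by
        rw [lintegral_prod _ (by fun_prop)]
        simp [mul_comm]
    _ = _ := by
        rw [Measure.toSphere_apply_univ, hdim, EuclideanSpace.volume_ball_fin_two,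
          Measure.volumeIoiPow, lintegral_withDensity_eq_lintegral_mul _ (by fun_prop) (by fun_prop),
          ← lintegral_subtype_comap measurableSet_Ioi]
        simp [ENNReal.ofReal_mul]

/-- The intensity measure of the pathloss process. -/
def lossIntensity (lam mu : ℝ) (alpha : LinkState → ℝ) : Measure ℝ :=
  (volume.restrict (Ioi 0)).withDensity fun l => ENNReal.ofReal (lossDensity lam mu alpha l)

lemma measurable_lossDensity (lam mu : ℝ) (alpha : LinkState → ℝ) :
    Measurable (lossDensity lam mu alpha) := by
  unfold lossDensity
  fun_prop

lemma lintegral_lossIntensity (lam mu : ℝ) (alpha : LinkState → ℝ) {H : ℝ → ℝ≥0∞}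
    (hH : Measurable H) :
    ∫⁻ l, H l ∂(lossIntensity lam mu alpha) =
      ∫⁻ l in Ioi 0, H l * ENNReal.ofReal (lossDensity lam mu alpha l) := by
  rw [lossIntensity, lintegral_withDensity_eq_lintegral_mul _
    (measurable_lossDensity _ _ _).ennreal_ofReal hH]
  simp [mul_comm]

/-- The substitution `r = l ^ (1 / a)`: the factor `r` and the Jacobian combine to `l ^ (2 / a - 1)
/ a`. -/
lemma lintegral_rpow_substitution {a : ℝ} (ha : 0 < a) (w : ℝ → ℝ)
    (H : ℝ → ℝ≥0∞) :
    ∫⁻ r in Ioi (0 : ℝ), ENNReal.ofReal r * (ENNReal.ofReal (w r) * H (r ^ a)) =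
      ∫⁻ l in Ioi (0 : ℝ), H l *
        ENNReal.ofReal (1 / a * l ^ (2 / a - 1) * w (l ^ (1 / a))) := by
  have himg : (fun l : ℝ => l ^ (1 / a)) '' Ioi 0 = Ioi 0 := by
    ext r
    constructor
    · rintro ⟨l, hl, rfl⟩
      exact Real.rpow_pos_of_pos hl _
    · intro hr
      refine ⟨r ^ a, Real.rpow_pos_of_pos hr _, ?_⟩
      dsimp only
      rw [← Real.rpow_mul (le_of_lt hr), mul_one_div_cancel ha.ne', Real.rpow_one]
  have hsub := lintegral_image_eq_lintegral_deriv_mul_of_monotoneOn (s := Ioi (0 : ℝ))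
    (f := fun l : ℝ => l ^ (1 / a)) (f' := fun l => 1 / a * l ^ (1 / a - 1)) measurableSet_Ioi
    (fun l hl => (Real.hasDerivAt_rpow_const (Or.inl (ne_of_gt hl))).hasDerivWithinAt)
    (fun x hx y hy h => Real.rpow_le_rpow (le_of_lt hx) h (by positivity))
    (fun r => ENNReal.ofReal r * (ENNReal.ofReal (w r) * H (r ^ a)))
  rw [himg] at hsub
  rw [hsub]
  refine setLIntegral_congr_fun measurableSet_Ioi fun l hl => ?_
  have hl0 : (0 : ℝ) < l := hl
  have hr : 0 < l ^ (1 / a) := Real.rpow_pos_of_pos hl0 _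
  rw [← Real.rpow_mul hl0.le, one_div_mul_cancel ha.ne', Real.rpow_one, ← mul_assoc, ← mul_assoc,
    ← ENNReal.ofReal_mul (by positivity), ← ENNReal.ofReal_mul (by positivity), mul_comm]
  congr 2
  rw [mul_assoc (1 / a), ← Real.rpow_add hl0]
  congr 3
  ring

/-- The pathlosses of the links to the points of a planar process of density `lam` have intensity
`lossIntensity`. -/
theorem lintegral_avgLoss {lam mu : ℝ} (hlam : 0 < lam) (hmu : 0 < mu) {alpha : LinkState → ℝ}
    (ha : ∀ t, 0 < alpha t) {H : ℝ → ℝ≥0∞} (hH : Measurable H) :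
    ENNReal.ofReal lam * ∫⁻ x : Plane, avgLoss alpha mu H ‖x‖ =
      ∫⁻ l, H l ∂(lossIntensity lam mu alpha) := by
  have hexp : ∀ r : ℝ, 0 < r → 0 ≤ 1 - Real.exp (-r / mu) := fun r hr =>
    sub_nonneg.2 (Real.exp_le_one_iff.2 (div_nonpos_of_nonpos_of_nonneg (by linarith) hmu.le))
  rw [lintegral_norm_plane (measurable_avgLoss alpha mu hH), lintegral_lossIntensity _ _ _ hH,
    setLIntegral_congr_fun measurableSet_Ioi (g := fun r =>
      ENNReal.ofReal r * (ENNReal.ofReal (Real.exp (-r / mu)) * H (r ^ alpha .los)) +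
      ENNReal.ofReal r * (ENNReal.ofReal (1 - Real.exp (-r / mu)) * H (r ^ alpha .nlos)))
      (fun r hr => by dsimp only; rw [avgLoss_eq alpha hmu H (le_of_lt hr), mul_add]),
    lintegral_add_left (by fun_prop),
    lintegral_rpow_substitution (ha .los) (fun r => Real.exp (-r / mu)),
    lintegral_rpow_substitution (ha .nlos) (fun r => 1 - Real.exp (-r / mu)),
    ← lintegral_add_left (by fun_prop), ← mul_assoc, ← ENNReal.ofReal_mul hlam.le,
    ← lintegral_const_mul' _ _ ENNReal.ofReal_ne_top]
  refine setLIntegral_congr_fun measurableSet_Ioi fun l hl => ?_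
  have hl0 : (0 : ℝ) < l := hl
  have h1 := ha .los
  have h2 := ha .nlos
  have h3 := hexp _ (Real.rpow_pos_of_pos hl0 (1 / alpha .nlos))
  rw [← mul_add, ← ENNReal.ofReal_add (by positivity) (by positivity), mul_left_comm,
    ← ENNReal.ofReal_mul (by positivity), lossDensity]
  congr 2
  ring

lemma lossDensity_nonneg {lam mu : ℝ} (hlam : 0 < lam) (hmu : 0 < mu) {alpha : LinkState → ℝ}
    (ha : ∀ t, 0 < alpha t) {l : ℝ} (hl : 0 < l) : 0 ≤ lossDensity lam mu alpha l := by
  have h1 := ha .los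
  have h2 := ha .nlos
  have h3 : 0 ≤ 1 - Real.exp (-l ^ (1 / alpha .nlos) / mu) := sub_nonneg.2 (Real.exp_le_one_iff.2
    (div_nonpos_of_nonpos_of_nonneg (by have := Real.rpow_pos_of_pos hl (1 / alpha .nlos); linarith)
      hmu.le))
  unfold lossDensity
  positivity

/-- The expression `mu * (mu - e ^ (-r / mu) * (r + mu))` is the integral of `t * e ^ (-t / mu)`
over `[0, r]`; it is composed here with `r = l ^ (1 / α)`. -/
lemma hasDerivAt_lossMeasure (lam : ℝ) {mu : ℝ} (hmu : 0 < mu) {alpha : LinkState → ℝ} {l : ℝ} (hl : 0 < l) :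
    HasDerivAt (lossMeasure lam mu alpha) (lossDensity lam mu alpha l) l := by
  have hr : ∀ t, HasDerivAt (fun l : ℝ => l ^ (1 / alpha t)) (1 / alpha t * l ^ (1 / alpha t - 1)) l :=
    fun t => Real.hasDerivAt_rpow_const (Or.inl hl.ne')
  have hg : ∀ t, HasDerivAt (fun l : ℝ => mu * (mu - Real.exp (-l ^ (1 / alpha t) / mu) *
      (l ^ (1 / alpha t) + mu)))
      (1 / alpha t * l ^ (2 / alpha t - 1) * Real.exp (-l ^ (1 / alpha t) / mu)) l := by
    intro t
    have h := ((((hr t).neg.div_const mu).exp.mul ((hr t).add_const mu)).const_sub mu).const_mul mu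
    refine h.congr_deriv ?_
    have e : l ^ (2 / alpha t - 1) = l ^ (1 / alpha t) * l ^ (1 / alpha t - 1) := by
      rw [← Real.rpow_add hl]
      congr 1
      ring
    rw [e]
    simp only [Pi.neg_apply]
    field_simp
    ring
  have hn : HasDerivAt (fun l : ℝ => l ^ (2 / alpha .nlos) / 2)
      (1 / alpha .nlos * l ^ (2 / alpha .nlos - 1)) l := by
    refine ((Real.hasDerivAt_rpow_const (p := 2 / alpha .nlos) (Or.inl hl.ne')).div_const 2).congr_deriv ?_
    ring
  refine ((((hg .los).add hn).sub (hg .nlos)).const_mul (2 * Real.pi * lam)).congr_deriv ?_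
  rw [lossDensity]
  ring

lemma continuous_lossMeasure (lam : ℝ) (mu : ℝ) {alpha : LinkState → ℝ}
    (ha : ∀ t, 0 < alpha t) : Continuous (lossMeasure lam mu alpha) := by
  have h : ∀ t, ∀ c : ℝ, 0 ≤ c → Continuous fun l : ℝ => l ^ (c / alpha t) := fun t c hc =>
    Real.continuous_rpow_const (div_nonneg hc (ha t).le)
  have h1 := h .los 1 zero_le_one
  have h2 := h .nlos 1 zero_le_one
  have h3 := h .nlos 2 zero_le_two
  unfold lossMeasure
  fun_prop

lemma lossMeasure_zero (lam : ℝ) (mu : ℝ) {alpha : LinkState → ℝ}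
    (ha : ∀ t, 0 < alpha t) : lossMeasure lam mu alpha 0 = 0 := by
  have h1 := (ha .los).ne'
  have h2 := (ha .nlos).ne'
  simp [lossMeasure, Real.zero_rpow, h1, h2]

theorem lossIntensity_Iio {lam mu : ℝ} (hlam : 0 < lam) (hmu : 0 < mu) {alpha : LinkState → ℝ}
    (ha : ∀ t, 0 < alpha t) {c : ℝ} (hc : 0 ≤ c) :
    lossIntensity lam mu alpha (Iio c) = ENNReal.ofReal (lossMeasure lam mu alpha c) := by
  have hd : ∀ x ∈ Ioo 0 c, HasDerivAt (lossMeasure lam mu alpha) (lossDensity lam mu alpha x) x :=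
    fun x hx => hasDerivAt_lossMeasure lam hmu hx.1
  have hnn : ∀ x ∈ Ioo 0 c, 0 ≤ lossDensity lam mu alpha x :=
    fun x hx => lossDensity_nonneg hlam hmu ha hx.1
  have hcont := (continuous_lossMeasure lam mu ha).continuousOn (s := Icc 0 c)
  -- The density may be unbounded near `0`; its integrability comes from nonnegativity together with
  -- the continuity of its primitive up to `0`.
  have hint : IntegrableOn (lossDensity lam mu alpha) (Ioc 0 c) :=
    intervalIntegral.integrableOn_deriv_of_nonneg hcont hd hnn
  have hI := intervalIntegral.integral_eq_sub_of_hasDerivAt_of_le hc hcont hd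
    ((intervalIntegrable_iff_integrableOn_Ioc_of_le hc).2 hint)
  rw [lossMeasure_zero lam mu ha, sub_zero, intervalIntegral.integral_of_le hc,
    integral_Ioc_eq_integral_Ioo] at hI
  rw [lossIntensity, withDensity_apply _ measurableSet_Iio, Measure.restrict_restrict measurableSet_Iio,
    inter_comm, Ioi_inter_Iio, ← hI, ofReal_integral_eq_lintegral_ofReal
      (hint.mono_set Ioo_subset_Ioc_self)]
  exact (ae_restrict_iff' measurableSet_Ioo).2 (.of_forall hnn)

/-! ### Laws of the fadings and gains -/

lemma expMeasure_eq_withDensity (r : ℝ) :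
    expMeasure r = volume.withDensity (exponentialPDF r) := rfl

instance : IsProbabilityMeasure (expMeasure 1) := isProbabilityMeasure_expMeasure one_pos

lemma measurable_exponentialPDF (r : ℝ) : Measurable (exponentialPDF r) :=
  (measurable_exponentialPDFReal r).ennreal_ofReal

/-- The exponential tail, valid for thresholds in `[0, ∞]`: no real fading reaches `∞`. -/
lemma expMeasure_le_ofReal (T : ℝ≥0∞) :
    expMeasure 1 {h | T ≤ ENNReal.ofReal h} = expNeg T := by
  by_cases hT : T = ∞
  · simp [hT]
  lift T to ℝ≥0 using hT
  -- At `T = 0` the set is the whole line, negative numbers included, and not `Ici 0`.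
  rcases eq_or_ne T 0 with rfl | h0
  · simp
  have hset : {h : ℝ | (T : ℝ≥0∞) ≤ ENNReal.ofReal h} = Ici (T : ℝ) := by
    ext h
    simp only [mem_ofPred_eq, mem_Ici]
    rw [ENNReal.ofReal, ENNReal.coe_le_coe, Real.le_toNNReal_iff_coe_le' (pos_iff_ne_zero.2 h0)]
  have hIic : expMeasure 1 (Iic (T : ℝ)) = ENNReal.ofReal (1 - Real.exp (-T)) := by
    rw [← ofReal_cdf, cdf_expMeasure_eq one_pos, if_pos T.coe_nonneg, one_mul]
  have : NullSingletonClass (expMeasure 1) := by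
    rw [expMeasure_eq_withDensity]
    infer_instance
  rw [hset, ← ENNReal.ofReal_coe_nnreal (p := T), expNeg_ofReal T.coe_nonneg, ← measure_congr Ioi_ae_eq_Ici, ← compl_Iic,
    prob_compl_eq_one_sub measurableSet_Iic, hIic, ← ENNReal.ofReal_one,
    ← ENNReal.ofReal_sub _ (sub_nonneg.2 (Real.exp_le_one_iff.2 (by simp)))]
  simp

/-- Tilting the unit exponential density by `e ^ (-a * h)` gives `1 / (1 + a)` times the exponential
density of rate `1 + a`. -/
lemma lintegral_expNeg_expMeasure {a : ℝ} (ha : 0 ≤ a) :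
    ∫⁻ h, expNeg (ENNReal.ofReal (a * h)) ∂(expMeasure 1) = ENNReal.ofReal (1 / (1 + a)) := by
  have ha1 : 0 < 1 + a := by linarith
  rw [expMeasure_eq_withDensity, lintegral_withDensity_eq_lintegral_mul _
    (measurable_exponentialPDF 1)
    (show Measurable fun h => expNeg (ENNReal.ofReal (a * h)) from
      measurable_expNeg.comp (by fun_prop))]
  have h : ∀ x, (exponentialPDF 1 * fun x => expNeg (ENNReal.ofReal (a * x))) x =
      ENNReal.ofReal (1 / (1 + a)) * exponentialPDF (1 + a) x := by
    intro x
    rw [Pi.mul_apply]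
    rcases lt_or_ge x 0 with hx | hx
    · simp [exponentialPDF_of_neg hx]
    · rw [exponentialPDF_of_nonneg hx, exponentialPDF_of_nonneg hx, expNeg_ofReal (by positivity),
        ← ENNReal.ofReal_mul (by positivity), ← ENNReal.ofReal_mul (by positivity), ← mul_assoc,
        one_div_mul_cancel ha1.ne', one_mul, one_mul, ← Real.exp_add]
      congr 2
      ring_nf
  simp_rw [h]
  rw [lintegral_const_mul _ (measurable_exponentialPDF _), lintegral_exponentialPDF_eq_one ha1, mul_one]

lemma Params.gainProb_nonneg (p : Params) (b : Bool × Bool) : 0 ≤ p.gainProb b := by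
  have h1 := p.thetaS_mem.1
  have h2 := p.thetaU_mem.1
  have h3 : 0 ≤ 2 * Real.pi - p.thetaS := by linarith [p.thetaS_mem.2]
  have h4 : 0 ≤ 2 * Real.pi - p.thetaU := by linarith [p.thetaU_mem.2]
  unfold Params.gainProb
  split_ifs <;> positivity

lemma Params.gainVal_nonneg (p : Params) (b : Bool × Bool) : 0 ≤ p.gainVal b := by
  have h1 := (p.gain_pos .sbs).le
  have h2 := p.gainU_pos.le
  have h3 := p.sideS_nonneg
  have h4 := p.sideU_nonneg
  unfold Params.gainVal
  split_ifs <;> positivity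

lemma Params.sum_gainProb (p : Params) : ∑ b, p.gainProb b = 1 := by
  simp only [Fintype.sum_prod_type, Fintype.sum_bool, Params.gainProb, if_true, Bool.false_eq_true,
    if_false]
  have h : ∀ x : ℝ, x / (2 * Real.pi) + (2 * Real.pi - x) / (2 * Real.pi) = 1 := fun x => by
    rw [← add_div, add_sub_cancel, div_self (by positivity)]
  linear_combination (h p.thetaS) * (p.thetaU / (2 * Real.pi) +
    (2 * Real.pi - p.thetaU) / (2 * Real.pi)) + h p.thetaU

lemma Params.lintegral_gainLaw (p : Params) (f : ℝ → ℝ≥0∞) (hf : Measurable f) :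
    ∫⁻ g, f g ∂p.gainLaw = ∑ b, ENNReal.ofReal (p.gainProb b) * f (p.gainVal b) := by
  rw [Params.gainLaw, lintegral_finsetSum_measure]
  simp [lintegral_dirac' _ hf]

instance (p : Params) : IsProbabilityMeasure p.gainLaw := ⟨by
  have := p.lintegral_gainLaw (fun _ => 1) measurable_const
  rw [lintegral_one] at this
  simp [this, ← ENNReal.ofReal_sum_of_nonneg fun b _ => p.gainProb_nonneg b, p.sum_gainProb]⟩

/-! ### Independent blocks of marks and an exponential race -/

/-- Functions of disjoint finite blocks of independent variables are independent; the index set is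
enlarged one block at a time, the new block being independent of the union of the earlier ones. -/
lemma iIndepFun_of_dependsOn {Ω ι J : Type*} [MeasurableSpace Ω] {P : Measure Ω}
    [IsProbabilityMeasure P] {f : ι → Ω → ℝ} (hf : iIndepFun f P) (hm : ∀ i, Measurable (f i))
    {γ : Type*} [MeasurableSpace γ] (S : J → Finset ι)
    (hS : Pairwise fun i j => Disjoint (S i) (S j)) (Φ : J → (ι → ℝ) → γ)
    (hΦ : ∀ j, Measurable (Φ j)) (hdep : ∀ j, DependsOn (Φ j) (S j)) :
    iIndepFun (fun j ω => Φ j fun i => f i ω) P := by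
  classical
  -- Extension by zero outside `T` makes `Φ j` a function of finitely many coordinates without
  -- changing its value when its block lies in `T`.
  set ext : (T : Finset ι) → (T → ℝ) → ι → ℝ := fun T v i =>
    if hi : i ∈ T then v ⟨i, hi⟩ else 0 with hext
  have hextm : ∀ T, Measurable (ext T) := fun T => measurable_pi_lambda _ fun i => by
    simp only [hext]
    split_ifs
    · exact measurable_pi_apply _
    · exact measurable_const
  have hΦe : ∀ (T : Finset ι) j, S j ⊆ T → ∀ ω,
      Φ j (ext T fun i => f i ω) = Φ j fun i => f i ω := fun T j hj ω =>
    hdep j fun i hi => by simp [hext, hj hi]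
  rw [iIndepFun_iff_measure_inter_preimage_eq_mul]
  intro T A hA
  induction T using Finset.induction_on with
  | empty => simp
  | insert a T ha ih =>
    rw [Finset.prod_insert ha, Finset.set_biInter_insert,
      ← ih fun i hi => hA i (Finset.mem_insert_of_mem hi)]
    have hd : Disjoint (S a) (T.biUnion S) :=
      (Finset.disjoint_biUnion_right _ _ _).2 fun j hj => hS fun h => ha (h ▸ hj)
    have hi := hf.indepFun_finset (S a) (T.biUnion S) hd hm
    have h := hi.measure_inter_preimage_eq_mul (ext (S a) ⁻¹' (Φ a ⁻¹' A a))
      (⋂ j ∈ T, ext (T.biUnion S) ⁻¹' (Φ j ⁻¹' A j))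
      (hextm _ (hΦ a (hA a (Finset.mem_insert_self a T))))
      (Finset.measurableSet_biInter T fun j hj =>
        hextm _ (hΦ j (hA j (Finset.mem_insert_of_mem hj))))
    have e1 : (fun ω (i : S a) => f i ω) ⁻¹' (ext (S a) ⁻¹' (Φ a ⁻¹' A a)) =
        (fun ω => Φ a fun i => f i ω) ⁻¹' A a := by
      ext ω
      exact iff_of_eq (congrArg (· ∈ A a) (hΦe (S a) a subset_rfl ω))
    have e2 : (fun ω (i : T.biUnion S) => f i ω) ⁻¹'
        (⋂ j ∈ T, ext (T.biUnion S) ⁻¹' (Φ j ⁻¹' A j)) =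
        ⋂ j ∈ T, (fun ω => Φ j fun i => f i ω) ⁻¹' A j := by
      simp only [preimage_iInter]
      refine iInter₂_congr fun j hj => ?_
      ext ω
      exact iff_of_eq (congrArg (· ∈ A j)
        (hΦe (T.biUnion S) j (Finset.subset_biUnion_of_mem S hj) ω))
    rwa [e1, e2] at h

/-- Independence factors the finite sums; since `expNeg ≤ 1`, dominated convergence along finite
subsets gives the full sum. -/
lemma lintegral_expNeg_tsum {Ω J : Type*} [MeasurableSpace Ω] {P : Measure Ω}
    [IsProbabilityMeasure P] [Countable J] {Z : J → Ω → ℝ≥0∞} (hm : ∀ j, Measurable (Z j))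
    (hind : iIndepFun Z P) {z : J → ℝ≥0∞} (hz : ∀ j, ∫⁻ ω, expNeg (Z j ω) ∂P = expNeg (z j)) :
    ∫⁻ ω, expNeg (∑' j, Z j ω) ∂P = expNeg (∑' j, z j) := by
  have h1 : Tendsto (fun s : Finset J => ∫⁻ ω, expNeg (∑ j ∈ s, Z j ω) ∂P) atTop
      (𝓝 (∫⁻ ω, expNeg (∑' j, Z j ω) ∂P)) := by
    refine tendsto_lintegral_filter_of_dominated_convergence (fun _ => 1)
      (.of_forall fun s => measurable_expNeg.comp (Finset.measurable_fun_sum s fun j _ => hm j))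
      (.of_forall fun s => .of_forall fun ω => expNeg_le_one _) (by simp) (.of_forall fun ω => ?_)
    exact (continuous_expNeg.tendsto _).comp ENNReal.summable.hasSum
  have h2 : Tendsto (fun s : Finset J => expNeg (∑ j ∈ s, z j)) atTop (𝓝 (expNeg (∑' j, z j))) :=
    (continuous_expNeg.tendsto _).comp ENNReal.summable.hasSum
  refine tendsto_nhds_unique h1 (h2.congr fun s => ?_)
  simp_rw [expNeg_sum]
  rw [lintegral_prod_eq_prod_lintegral_of_indepFun s (fun j ω => expNeg (Z j ω))
    (hind.comp (fun _ => expNeg) fun _ => measurable_expNeg) (fun j => measurable_expNeg.comp (hm j))]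
  exact Finset.prod_congr rfl fun j _ => (hz j).symm

/-- Conditionally on the sum `S` of the other variables, the exponential variable `F none` is at
least `S` with probability `e ^ (-S)`; the mean of this factors over the summands. -/
lemma measure_tsum_le_of_iIndepFun {Ω J : Type*} [MeasurableSpace Ω] {P : Measure Ω}
    [IsProbabilityMeasure P] [Countable J] {F : Option J → Ω → ℝ≥0∞} (hm : ∀ j, Measurable (F j))
    (hind : iIndepFun F P) (htail : ∀ T, P {ω | T ≤ F none ω} = expNeg T) {z : J → ℝ≥0∞}
    (hz : ∀ j, ∫⁻ ω, expNeg (F (some j) ω) ∂P = expNeg (z j)) :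
    P {ω | ∑' j, F (some j) ω ≤ F none ω} = expNeg (∑' j, z j) := by
  classical
  have hproc : IndepFun (F none) (fun ω (j : J) => F (some j) ω) P := by
    refine IndepFun.indepFun_process (hm none) (fun j => hm (some j)) fun I => ?_
    have h := hind.indepFun_finset {none} (I.map Function.Embedding.some)
      (by simp) hm
    have hφ : Measurable fun v : ({none} : Finset (Option J)) → ℝ≥0∞ => v ⟨none, by simp⟩ :=
      measurable_pi_apply _
    have hψ : Measurable fun (v : I.map Function.Embedding.some → ℝ≥0∞) (j : I) =>
        v ⟨some j.1, by simp⟩ := measurable_pi_lambda _ fun j => measurable_pi_apply _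
    exact h.comp hφ hψ
  have hSm : Measurable fun ω => ∑' j, F (some j) ω := Measurable.tsum fun j => hm (some j)
  have hi : IndepFun (F none) (fun ω => ∑' j, F (some j) ω) P :=
    hproc.comp (ψ := fun v : J → ℝ≥0∞ => ∑' j, v j) measurable_id
      (Measurable.tsum fun j => measurable_pi_apply j)
  have hset : MeasurableSet {q : ℝ≥0∞ × ℝ≥0∞ | q.1 ≤ q.2} := measurableSet_le measurable_fst measurable_snd
  have hlaw := (indepFun_iff_map_prod_eq_prod_map_map hSm.aemeasurable (hm none).aemeasurable).1 hi.symm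
  have h1 : P {ω | ∑' j, F (some j) ω ≤ F none ω} =
      (P.map fun ω => (∑' j, F (some j) ω, F none ω)) {q : ℝ≥0∞ × ℝ≥0∞ | q.1 ≤ q.2} := by
    rw [Measure.map_apply (hSm.prodMk (hm none)) hset]
    rfl
  have := Measure.isProbabilityMeasure_map (μ := P) (hm none).aemeasurable
  rw [h1, hlaw, Measure.prod_apply hset, lintegral_map (measurable_measure_prodMk_left hset) hSm,
    ← lintegral_expNeg_tsum (fun j => hm (some j)) (hind.precomp (Option.some_injective J)) hz]
  refine lintegral_congr fun ω => ?_
  rw [Measure.map_apply (hm none) (measurable_prodMk_left hset)]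
  exact htail _

/-! ### One link against all others at a fixed level -/

/-- A doubly indexed family of independent marks: blocking variables, fadings and gains of the links
to one point process, and blocking variables of the links to another. -/
structure IsMarkField (p : Params) {Ω : Type*} [MeasurableSpace Ω] (P : Measure Ω)
    (m : Fin 4 × ℕ → Ω → ℝ) : Prop where
  measurable : ∀ j, Measurable (m j)
  indep : iIndepFun m P
  law_block : ∀ n, HasLaw (m (0, n)) (volume.restrict (Icc 0 1)) P
  law_fading : ∀ n, HasLaw (m (1, n)) (expMeasure 1) P
  law_gain : ∀ n, HasLaw (m (2, n)) p.gainLaw P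
  law_block' : ∀ n, HasLaw (m (3, n)) (volume.restrict (Icc 0 1)) P

/-- The expected attenuation factor of a point with pathloss `l`, for an interference coefficient
`s`, when points of pathloss below `c` are forbidden. -/
def attenuation (p : Params) (c s l : ℝ) : ℝ≥0∞ :=
  if c ≤ l then ∫⁻ g, ∫⁻ h, expNeg (ENNReal.ofReal (s * h * g * l⁻¹)) ∂(expMeasure 1) ∂p.gainLaw
  else 0

lemma measurable_attenuation (p : Params) (c s : ℝ) : Measurable (attenuation p c s) := by
  unfold attenuation
  refine Measurable.ite measurableSet_Ici ?_ measurable_const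
  refine Measurable.lintegral_prod_right' (f := fun z : ℝ × ℝ =>
    ∫⁻ h, expNeg (ENNReal.ofReal (s * h * z.2 * z.1⁻¹)) ∂(expMeasure 1)) ?_
  refine Measurable.lintegral_prod_right' (f := fun z : (ℝ × ℝ) × ℝ =>
    expNeg (ENNReal.ofReal (s * z.2 * z.1.2 * z.1.1⁻¹))) ?_
  exact measurable_expNeg.comp (by fun_prop)

lemma attenuation_le_one (p : Params) (c s l : ℝ) : attenuation p c s l ≤ 1 := by
  unfold attenuation
  split_ifs
  · refine (lintegral_mono fun g => lintegral_mono fun h => expNeg_le_one _).trans ?_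
    simp
  · exact zero_le_one

/-- The fading is integrated first, giving `1 / (1 + s * g / l)` for gain `g`; the gain then takes
its four values. -/
lemma attenuation_eq (p : Params) {c s l : ℝ} (hs : 0 ≤ s) (hl : 0 < l) (hc : c ≤ l) :
    attenuation p c s l =
      ENNReal.ofReal (∑ b, p.gainProb b * (1 / (1 + s * p.gainVal b / l))) := by
  have hb : ∀ b, 0 ≤ s * p.gainVal b * l⁻¹ := fun b =>
    mul_nonneg (mul_nonneg hs (p.gainVal_nonneg b)) (inv_nonneg.2 hl.le)
  rw [attenuation, if_pos hc, p.lintegral_gainLaw, ENNReal.ofReal_sum_of_nonneg]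
  · refine Finset.sum_congr rfl fun b _ => ?_
    rw [ENNReal.ofReal_mul (p.gainProb_nonneg b), div_eq_mul_inv (s * _), ← lintegral_expNeg_expMeasure (hb b)]
    congr 1
    refine lintegral_congr fun h => ?_
    congr 2
    ring
  · intro b _
    have := hb b
    have := p.gainProb_nonneg b
    rw [div_eq_mul_inv (s * _)]
    positivity
  · refine Measurable.lintegral_prod_right' (f := fun z : ℝ × ℝ =>
      expNeg (ENNReal.ofReal (s * z.2 * z.1 * l⁻¹))) ?_
    exact measurable_expNeg.comp (by fun_prop)

/-- The value `0` if `q` holds, and `∞` otherwise. -/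
def barrier (q : Prop) : ℝ≥0∞ := open Classical in if q then 0 else ∞

lemma barrier_pos {q : Prop} (h : q) : barrier q = 0 := if_pos h
lemma barrier_neg {q : Prop} (h : ¬ q) : barrier q = ∞ := if_neg h

lemma measurable_barrier {α : Type*} [MeasurableSpace α] {q : α → Prop}
    (h : MeasurableSet {a | q a}) : Measurable fun a => barrier (q a) := by
  classical
  exact Measurable.ite h measurable_const measurable_const

lemma expNeg_barrier_mem {S : Set ℝ} (l : ℝ) : expNeg (barrier (l ∈ S)) = S.indicator 1 l := by
  by_cases h : l ∈ S
  · rw [barrier_pos h, indicator_of_mem h, expNeg_zero, Pi.one_apply]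
  · rw [barrier_neg h, indicator_of_notMem h, expNeg_top]

lemma sumExcept_congr {n : ℕ} {f g : ℕ → ℝ≥0∞} (h : ∀ k, k ≠ n → f k = g k) :
    sumExcept n f = sumExcept n g := by
  refine tsum_congr fun k => ?_
  split_ifs with hk
  · rfl
  · exact h k hk

lemma sumExcept_mono {n : ℕ} {f g : ℕ → ℝ≥0∞} (h : ∀ k, f k ≤ g k) :
    sumExcept n f ≤ sumExcept n g := by
  refine ENNReal.tsum_le_tsum fun k => ?_
  split_ifs
  · exact le_rfl
  · exact h k

lemma le_sumExcept {n k : ℕ} (h : k ≠ n) (f : ℕ → ℝ≥0∞) : f k ≤ sumExcept n f :=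
  (if_neg h).symm.le.trans (ENNReal.le_tsum (f := fun k => if k = n then 0 else f k) k)

/-- Conditions on the links to the points `x k` and `y k` with marks `v`: the pathloss of `x n` lies in
`I`, those of the other points `x k` are at least `c` and those of the `y k` are at least `c'`, and the
fading of `x n` exceeds the noise `T` plus the interference of the other `x k`. -/
def RaceCond (aX aY : LinkState → ℝ) (mu : ℝ) (I : Set ℝ) (c c' s : ℝ) (T : ℝ≥0∞) (n : ℕ)
    (x y : ℕ → Plane) (v : Fin 4 × ℕ → ℝ) : Prop :=
  pathloss aX mu (v (0, n)) ‖x n‖ ∈ I ∧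
  (∀ k, k ≠ n → c ≤ pathloss aX mu (v (0, k)) ‖x k‖) ∧
  (∀ k, c' ≤ pathloss aY mu (v (3, k)) ‖y k‖) ∧
  T + sumExcept n (fun k => ENNReal.ofReal
    (s * v (1, k) * v (2, k) * (pathloss aX mu (v (0, k)) ‖x k‖)⁻¹)) ≤ ENNReal.ofReal (v (1, n))

/-- The terms in which `RaceCond` is an inequality between a sum and the fading of `x n`. -/
def raceTerm (aX aY : LinkState → ℝ) (mu : ℝ) (I : Set ℝ) (c c' s : ℝ) (T : ℝ≥0∞) (n : ℕ)
    (x y : ℕ → Plane) : Option (ℕ ⊕ ℕ) → (Fin 4 × ℕ → ℝ) → ℝ≥0∞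
  | none, v => ENNReal.ofReal (v (1, n))
  | some (.inl k), v =>
    if k = n then T + barrier (pathloss aX mu (v (0, n)) ‖x n‖ ∈ I) else
      barrier (c ≤ pathloss aX mu (v (0, k)) ‖x k‖) + ENNReal.ofReal
        (s * v (1, k) * v (2, k) * (pathloss aX mu (v (0, k)) ‖x k‖)⁻¹)
  | some (.inr k), v => barrier (c' ≤ pathloss aY mu (v (3, k)) ‖y k‖)

/-- The marks on which a term depends. -/
def raceSupport (n : ℕ) : Option (ℕ ⊕ ℕ) → Finset (Fin 4 × ℕ)
  | none => {(1, n)}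
  | some (.inl k) => if k = n then {(0, n)} else {(0, k), (1, k), (2, k)}
  | some (.inr k) => {(3, k)}

section

variable (aX aY : LinkState → ℝ) (mu : ℝ) {I : Set ℝ} (c c' s : ℝ) (T : ℝ≥0∞) (n : ℕ)

lemma measurable_raceTerm (hI : MeasurableSet I) (j : Option (ℕ ⊕ ℕ)) :
    Measurable fun z : ((ℕ → Plane) × (ℕ → Plane)) × (Fin 4 × ℕ → ℝ) =>
      raceTerm aX aY mu I c c' s T n z.1.1 z.1.2 j z.2 := by
  have hX : ∀ (a : LinkState → ℝ) (i : Fin 4) k,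
      Measurable fun z : ((ℕ → Plane) × (ℕ → Plane)) × (Fin 4 × ℕ → ℝ) =>
      pathloss a mu (z.2 (i, k)) ‖z.1.1 k‖ := fun a i k =>
    (measurable_pathloss a mu).comp (by fun_prop : Measurable fun
      z : ((ℕ → Plane) × (ℕ → Plane)) × (Fin 4 × ℕ → ℝ) => (z.2 (i, k), ‖z.1.1 k‖))
  have hY : ∀ (a : LinkState → ℝ) (i : Fin 4) k,
      Measurable fun z : ((ℕ → Plane) × (ℕ → Plane)) × (Fin 4 × ℕ → ℝ) =>
      pathloss a mu (z.2 (i, k)) ‖z.1.2 k‖ := fun a i k =>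
    (measurable_pathloss a mu).comp (by fun_prop : Measurable fun
      z : ((ℕ → Plane) × (ℕ → Plane)) × (Fin 4 × ℕ → ℝ) => (z.2 (i, k), ‖z.1.2 k‖))
  rcases j with _ | k | k
  · simp only [raceTerm]
    fun_prop
  · simp only [raceTerm]
    split_ifs
    · exact (measurable_barrier (hX aX 0 n hI)).const_add _
    · refine (measurable_barrier (measurableSet_le measurable_const (hX aX 0 k))).add ?_
      have := hX aX 0 k
      fun_prop
  · exact measurable_barrier (measurableSet_le measurable_const (hY aY 3 k))

/-- The fading on the right is finite, so the inequality forces every barrier in the sum to vanish;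
what remains is the noise plus the interference. The index `n` has no interference term of its own,
and its slot carries `T` and the condition on `I`. -/
lemma raceCond_iff (x y : ℕ → Plane) (v : Fin 4 × ℕ → ℝ) :
    RaceCond aX aY mu I c c' s T n x y v ↔
      ∑' j, raceTerm aX aY mu I c c' s T n x y (some j) v ≤
        raceTerm aX aY mu I c c' s T n x y none v := by
  have hsplit : ∑' j, raceTerm aX aY mu I c c' s T n x y (some j) v =
      T + barrier (pathloss aX mu (v (0, n)) ‖x n‖ ∈ I) +
      sumExcept n (fun k => barrier (c ≤ pathloss aX mu (v (0, k)) ‖x k‖) + ENNReal.ofReal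
        (s * v (1, k) * v (2, k) * (pathloss aX mu (v (0, k)) ‖x k‖)⁻¹)) +
      ∑' k, barrier (c' ≤ pathloss aY mu (v (3, k)) ‖y k‖) := by
    rw [ENNReal.summable.tsum_sum ENNReal.summable, ← add_sumExcept n]
    simp only [raceTerm, if_true]
    congr 2
    exact sumExcept_congr fun k hk => if_neg hk
  rw [hsplit]
  constructor
  · rintro ⟨h1, h2, h3, h4⟩
    simp only [barrier_pos h1, barrier_pos (h3 _), tsum_zero, add_zero]
    refine le_trans (le_of_eq ?_) h4
    congr 1
    exact sumExcept_congr fun k hk => by rw [barrier_pos (h2 k hk), zero_add]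
  · intro h
    have hfin := h.trans_lt ENNReal.ofReal_lt_top
    have h1 : pathloss aX mu (v (0, n)) ‖x n‖ ∈ I := by
      by_contra hc
      simp [barrier_neg hc] at hfin
    have h2 : ∀ k, k ≠ n → c ≤ pathloss aX mu (v (0, k)) ‖x k‖ := by
      intro k hk
      by_contra hc
      refine absurd hfin (not_lt.2 ?_)
      refine le_trans ?_ le_self_add
      refine le_trans ?_ le_add_self
      refine le_trans ?_ (le_sumExcept hk _)
      rw [barrier_neg hc, top_add]
    have h3 : ∀ k, c' ≤ pathloss aY mu (v (3, k)) ‖y k‖ := by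
      intro k
      by_contra hc
      refine absurd hfin (not_lt.2 ?_)
      refine le_trans ?_ le_add_self
      refine le_trans ?_ (ENNReal.le_tsum k)
      rw [barrier_neg hc]
    refine ⟨h1, h2, h3, le_trans ?_ h⟩
    refine le_trans ?_ le_self_add
    refine add_le_add le_self_add (sumExcept_mono fun k => le_add_self)

lemma measurableSet_raceCond (hI : MeasurableSet I) :
    MeasurableSet {z : ((ℕ → Plane) × (ℕ → Plane)) × (Fin 4 × ℕ → ℝ) |
      RaceCond aX aY mu I c c' s T n z.1.1 z.1.2 z.2} := by
  simp_rw [raceCond_iff]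
  exact measurableSet_le (Measurable.tsum fun j => measurable_raceTerm aX aY mu c c' s T n hI _)
    (measurable_raceTerm aX aY mu c c' s T n hI _)

/-- The fading `(1, n)` is assigned to `none` alone: the slot of the `n`-th point uses only its
blocking variable. This separates the two sides of the race. -/
lemma raceSupport_disjoint : Pairwise fun i j => Disjoint (raceSupport n i) (raceSupport n j) := by
  intro i j hij
  rw [Finset.disjoint_left]
  rcases i with _ | k | k <;> rcases j with _ | l | l <;> simp only [raceSupport] <;>
    (try split_ifs) <;> aesop

lemma dependsOn_raceTerm (x y : ℕ → Plane) (j : Option (ℕ ⊕ ℕ)) :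
    DependsOn (raceTerm aX aY mu I c c' s T n x y j) (raceSupport n j : Set (Fin 4 × ℕ)) := by
  intro v w h
  rcases j with _ | k | k
  · simp only [raceTerm, raceSupport] at h ⊢
    rw [h _ (by simp)]
  · simp only [raceTerm, raceSupport] at h ⊢
    split_ifs at h ⊢
    · rw [h _ (by simp)]
    · rw [h (0, k) (by simp), h (1, k) (by simp), h (2, k) (by simp)]
  · simp only [raceTerm, raceSupport] at h ⊢
    rw [h _ (by simp)]

end

section

variable {p : Params} {Ω : Type*} [MeasurableSpace Ω] {P : Measure Ω} {m : Fin 4 × ℕ → Ω → ℝ}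

lemma lintegral_expNeg_barrier_pathloss {U : Ω → ℝ} (hU : HasLaw U (volume.restrict (Icc 0 1)) P)
    (a : LinkState → ℝ) (mu r : ℝ) {S : Set ℝ} (hS : MeasurableSet S) :
    ∫⁻ ω, expNeg (barrier (pathloss a mu (U ω) r ∈ S)) ∂P = avgLoss a mu (S.indicator 1) r := by
  simp_rw [expNeg_barrier_mem]
  have hm : Measurable fun u => S.indicator (1 : ℝ → ℝ≥0∞) (pathloss a mu u r) :=
    (measurable_one.indicator hS).comp
      ((measurable_pathloss a mu).comp (measurable_id.prodMk measurable_const))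
  exact hU.lintegral_comp hm.aemeasurable

variable [IsProbabilityMeasure P]

/-- Blocking, gain and fading of a link are independent, so the mean is an iterated integral; the
barrier kills the integrand when the pathloss is below `c`. -/
lemma IsMarkField.lintegral_attenuation (hm : IsMarkField p P m) (k : ℕ) (a : LinkState → ℝ)
    (mu c s r : ℝ) :
    ∫⁻ ω, expNeg (barrier (c ≤ pathloss a mu (m (0, k) ω) r) + ENNReal.ofReal
      (s * m (1, k) ω * m (2, k) ω * (pathloss a mu (m (0, k) ω) r)⁻¹)) ∂P =
      avgLoss a mu (attenuation p c s) r := by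
  have hpl : Measurable fun z : ℝ × ℝ × ℝ => pathloss a mu z.1 r :=
    (measurable_pathloss a mu).comp (measurable_fst.prodMk measurable_const)
  set F : ℝ × ℝ × ℝ → ℝ≥0∞ := fun z => expNeg (barrier (c ≤ pathloss a mu z.1 r) + ENNReal.ofReal
      (s * z.2.2 * z.2.1 * (pathloss a mu z.1 r)⁻¹)) with hF
  have hFm : Measurable F := by
    refine measurable_expNeg.comp ((measurable_barrier (measurableSet_le measurable_const hpl)).add ?_)
    fun_prop
  have hi1 : IndepFun (m (2, k)) (m (1, k)) P := hm.indep.indepFun (by simp)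
  have hi2 : IndepFun (m (0, k)) (fun ω => (m (2, k) ω, m (1, k) ω)) P :=
    (hm.indep.indepFun_prodMk hm.measurable (2, k) (1, k) (0, k) (by simp) (by simp)).symm
  have hlaw : P.map (fun ω => (m (0, k) ω, m (2, k) ω, m (1, k) ω)) =
      (volume.restrict (Icc 0 1)).prod (p.gainLaw.prod (expMeasure 1)) := by
    rw [(indepFun_iff_map_prod_eq_prod_map_map (hm.measurable _).aemeasurable
      ((hm.measurable _).prodMk (hm.measurable _)).aemeasurable).1 hi2,
      (indepFun_iff_map_prod_eq_prod_map_map (hm.measurable _).aemeasurable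
      (hm.measurable _).aemeasurable).1 hi1, (hm.law_block k).map_eq, (hm.law_gain k).map_eq,
      (hm.law_fading k).map_eq]
  have h1 : ∫⁻ ω, F (m (0, k) ω, m (2, k) ω, m (1, k) ω) ∂P = avgLoss a mu (attenuation p c s) r := by
    rw [← lintegral_map (μ := P) hFm ((hm.measurable _).prodMk ((hm.measurable _).prodMk (hm.measurable _))),
      hlaw, lintegral_prod _ hFm.aemeasurable]
    refine lintegral_congr fun u => ?_
    rw [lintegral_prod (fun z => F (u, z)) (hFm.comp (measurable_const.prodMk measurable_id)).aemeasurable]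
    simp only [hF, attenuation]
    split_ifs with hc
    · simp [barrier_pos hc]
    · simp [barrier_neg hc]
  exact h1

/-- With the positions frozen, all terms of the race are independent, and the probability is the
product of their means. `negLog` writes each factor as an exponential, to suit the Poisson formulas.
-/
lemma IsMarkField.measure_raceCond (hm : IsMarkField p P m) (aX aY : LinkState → ℝ) (mu : ℝ)
    {I : Set ℝ} (hI : MeasurableSet I) (c c' s : ℝ) (T : ℝ≥0∞) (n : ℕ) (x y : ℕ → Plane) :
    P {ω | RaceCond aX aY mu I c c' s T n x y fun j => m j ω} =
      expNeg T * (avgLoss aX mu (I.indicator 1) ‖x n‖ *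
        expNeg (sumExcept n fun k => negLog (avgLoss aX mu (attenuation p c s) ‖x k‖)) *
        expNeg (∑' k, negLog (avgLoss aY mu ((Ici c').indicator 1) ‖y k‖))) := by
  have hind1 : ∀ (S : Set ℝ) l, S.indicator (1 : ℝ → ℝ≥0∞) l ≤ 1 := fun S l =>
    indicator_le_self' (fun _ _ => zero_le) l
  have hmeas : ∀ j, Measurable (raceTerm aX aY mu I c c' s T n x y j) := fun j =>
    (measurable_raceTerm aX aY mu c c' s T n hI j).comp
      ((measurable_const (a := (x, y))).prodMk measurable_id)
  have hmω : Measurable fun ω j => m j ω := measurable_pi_lambda _ hm.measurable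
  simp_rw [raceCond_iff]
  set zX : ℕ → ℝ≥0∞ := fun k => if k = n then T + negLog (avgLoss aX mu (I.indicator 1) ‖x n‖) else
      negLog (avgLoss aX mu (attenuation p c s) ‖x k‖) with hzX
  set zY : ℕ → ℝ≥0∞ := fun k => negLog (avgLoss aY mu ((Ici c').indicator 1) ‖y k‖)
  have hzX' : ∀ k, ∫⁻ ω, expNeg (raceTerm aX aY mu I c c' s T n x y (some (.inl k)) fun i => m i ω) ∂P
      = expNeg (zX k) := by
    intro k
    simp only [raceTerm, hzX]
    split_ifs
    · simp_rw [expNeg_add]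
      rw [lintegral_const_mul' _ _ (expNeg_ne_top _),
        lintegral_expNeg_barrier_pathloss (hm.law_block n) aX mu _ hI,
        expNeg_negLog (avgLoss_le_one _ _ (hind1 I) _)]
    · rw [hm.lintegral_attenuation,
        expNeg_negLog (avgLoss_le_one _ _ (attenuation_le_one p c s) _)]
  have hzY' : ∀ k, ∫⁻ ω, expNeg (raceTerm aX aY mu I c c' s T n x y (some (.inr k)) fun i => m i ω) ∂P
      = expNeg (zY k) := by
    intro k
    simp only [raceTerm, zY]
    rw [expNeg_negLog (avgLoss_le_one _ _ (hind1 _) _)]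
    exact lintegral_expNeg_barrier_pathloss (hm.law_block' k) aY mu _ measurableSet_Ici
  have htail : ∀ t : ℝ≥0∞,
      P {ω | t ≤ raceTerm aX aY mu I c c' s T n x y none fun i => m i ω} = expNeg t := by
    intro t
    rw [← expMeasure_le_ofReal]
    exact (hm.law_fading n).measure_eq (p := fun h => t ≤ ENNReal.ofReal h)
        (measurableSet_le measurable_const ENNReal.measurable_ofReal)
  have hind := iIndepFun_of_dependsOn hm.indep hm.measurable (raceSupport n) (raceSupport_disjoint n)
    (raceTerm aX aY mu I c c' s T n x y) hmeas (dependsOn_raceTerm aX aY mu c c' s T n x y)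
  have hkey := measure_tsum_le_of_iIndepFun
    (F := fun j ω => raceTerm aX aY mu I c c' s T n x y j fun i => m i ω) (fun j => (hmeas j).comp hmω) hind htail
    (z := Sum.elim zX zY) (by
      rintro (k | k)
      · exact hzX' k
      · exact hzY' k)
  have hzn : zX n = T + negLog (avgLoss aX mu (I.indicator 1) ‖x n‖) := if_pos rfl
  have hzk : sumExcept n zX =
      sumExcept n fun k => negLog (avgLoss aX mu (attenuation p c s) ‖x k‖) :=
    sumExcept_congr fun k hk => if_neg hk
  rw [hkey, ENNReal.summable.tsum_sum ENNReal.summable]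
  simp only [Sum.elim_inl, Sum.elim_inr]
  rw [expNeg_add, ← add_sumExcept n zX, expNeg_add, hzn, hzk, expNeg_add,
    expNeg_negLog (avgLoss_le_one _ _ (hind1 I) _), mul_assoc, mul_assoc, mul_assoc]

/-- The sum over the points of a Poisson process of the probabilities of `RaceCond`. -/
theorem sum_measure_raceCond {X Y : ℕ → Ω → Plane} {lX lY mu : ℝ} (hlX : 0 < lX) (hlY : 0 < lY)
    (hmu : 0 < mu) {aX aY : LinkState → ℝ} (haX : ∀ t, 0 < aX t) (haY : ∀ t, 0 < aY t)
    (hX : IsPoissonProcess P X lX) (hY : IsPoissonProcess P Y lY)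
    (hXY : IndepFun (fun ω n => X n ω) (fun ω n => Y n ω) P) (hm : IsMarkField p P m)
    (hpm : IndepFun (fun ω => (fun n => X n ω, fun n => Y n ω)) (fun ω j => m j ω) P)
    {I : Set ℝ} (hI : MeasurableSet I) (hIfin : lossIntensity lX mu aX I ≠ ∞) (c c' s : ℝ)
    (T : ℝ≥0∞) :
    ∑' n, P {ω | RaceCond aX aY mu I c c' s T n (fun k => X k ω) (fun k => Y k ω) fun j => m j ω} =
      lossIntensity lX mu aX I * (expNeg T *
        expNeg (∫⁻ l, (1 - attenuation p c s l) ∂(lossIntensity lX mu aX)) *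
        expNeg (lossIntensity lY mu aY (Iio c'))) := by
  have hind1 : ∀ (S : Set ℝ) l, S.indicator (1 : ℝ → ℝ≥0∞) l ≤ 1 := fun S l =>
    indicator_le_self' (fun _ _ => zero_le) l
  have hXm : Measurable fun ω n => X n ω := measurable_pi_lambda _ hX.measurable
  have hYm : Measurable fun ω n => Y n ω := measurable_pi_lambda _ hY.measurable
  have hmω : Measurable fun ω j => m j ω := measurable_pi_lambda _ hm.measurable
  set g : Plane → ℝ≥0∞ := fun x => avgLoss aX mu (I.indicator 1) ‖x‖ with hg
  set u : Plane → ℝ≥0∞ := fun x => negLog (avgLoss aX mu (attenuation p c s) ‖x‖) with hu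
  set w : Plane → ℝ≥0∞ := fun x => negLog (avgLoss aY mu ((Ici c').indicator 1) ‖x‖) with hw
  have hgm : Measurable g :=
    (measurable_avgLoss aX mu (measurable_one.indicator hI)).comp measurable_norm
  have hum : Measurable u := measurable_negLog.comp
    ((measurable_avgLoss aX mu (measurable_attenuation p c s)).comp measurable_norm)
  have hwm : Measurable w := measurable_negLog.comp
    ((measurable_avgLoss aY mu (measurable_one.indicator measurableSet_Ici)).comp measurable_norm)
  have hgint : ENNReal.ofReal lX * ∫⁻ x, g x = lossIntensity lX mu aX I := by
    rw [hg, lintegral_avgLoss hlX hmu haX (measurable_one.indicator hI), lintegral_indicator_one hI]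
  have huint : ENNReal.ofReal lX * ∫⁻ x, (1 - expNeg (u x)) =
      ∫⁻ l, (1 - attenuation p c s l) ∂(lossIntensity lX mu aX) := by
    rw [← lintegral_avgLoss hlX hmu haX (H := fun l => 1 - attenuation p c s l)
      (measurable_const.sub (measurable_attenuation p c s))]
    congr 1
    refine lintegral_congr fun x => ?_
    rw [hu, expNeg_negLog (avgLoss_le_one _ _ (attenuation_le_one p c s) _),
      one_sub_avgLoss _ _ (measurable_attenuation p c s) (attenuation_le_one p c s)]
  have hwint : ENNReal.ofReal lY * ∫⁻ x, (1 - expNeg (w x)) = lossIntensity lY mu aY (Iio c') := by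
    rw [← lintegral_indicator_one measurableSet_Iio,
      ← lintegral_avgLoss hlY hmu haY (measurable_one.indicator measurableSet_Iio)]
    congr 1
    refine lintegral_congr fun x => ?_
    rw [hw, expNeg_negLog (avgLoss_le_one _ _ (hind1 _) _),
      one_sub_avgLoss _ _ (measurable_one.indicator measurableSet_Ici) (hind1 _)]
    congr 1
    ext l
    by_cases hl : c' ≤ l
    · simp [hl, not_lt.2 hl]
    · simp [hl, not_le.1 hl]
  have hterm : ∀ n, P {ω | RaceCond aX aY mu I c c' s T n (fun k => X k ω) (fun k => Y k ω)
      fun j => m j ω} = (∫⁻ ω, g (X n ω) * expNeg (sumExcept n fun k => u (X k ω)) ∂P) *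
        (expNeg T * expNeg (lossIntensity lY mu aY (Iio c'))) := by
    intro n
    have hset := measurableSet_raceCond aX aY mu c c' s T n hI
    -- The marks are independent of the points, so Fubini freezes the positions.
    have hS : P {ω | RaceCond aX aY mu I c c' s T n (fun k => X k ω) (fun k => Y k ω)
        fun j => m j ω} = ∫⁻ ω, P {ω' | RaceCond aX aY mu I c c' s T n (fun k => X k ω)
          (fun k => Y k ω) fun j => m j ω'} ∂P := by
      have e1 : P {ω | RaceCond aX aY mu I c c' s T n (fun k => X k ω) (fun k => Y k ω)
          fun j => m j ω} = (P.map fun ω => ((fun n => X n ω, fun n => Y n ω), fun j => m j ω))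
            {z | RaceCond aX aY mu I c c' s T n z.1.1 z.1.2 z.2} := by
        rw [Measure.map_apply ((hXm.prodMk hYm).prodMk hmω) hset]
        rfl
      have := Measure.isProbabilityMeasure_map (μ := P) hmω.aemeasurable
      rw [e1, (indepFun_iff_map_prod_eq_prod_map_map (hXm.prodMk hYm).aemeasurable
        hmω.aemeasurable).1 hpm, Measure.prod_apply hset,
        lintegral_map (measurable_measure_prodMk_left hset) (hXm.prodMk hYm)]
      refine lintegral_congr fun ω => ?_
      rw [Measure.map_apply hmω (measurable_prodMk_left hset)]
      rfl
    rw [hS]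
    simp_rw [hm.measure_raceCond aX aY mu hI]
    rw [lintegral_const_mul' _ _ (expNeg_ne_top _), mul_left_comm]
    congr 1
    have hA : Measurable fun x : ℕ → Plane => g (x n) * expNeg (sumExcept n fun k => u (x k)) :=
      (hgm.comp (measurable_pi_apply n)).mul (measurable_expNeg.comp
        (measurable_sumExcept n fun k => hum.comp (measurable_pi_apply k)))
    have hB : Measurable fun y : ℕ → Plane => expNeg (∑' k, w (y k)) :=
      measurable_expNeg.comp (Measurable.tsum fun k => hwm.comp (measurable_pi_apply k))
    -- The two point processes are independent and enter through separate factors: the one of `Y` is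
    -- a Laplace functional, the one of `X` a Mecke term.
    have hprod := lintegral_mul_eq_lintegral_mul_lintegral_of_indepFun (hA.comp hXm) (hB.comp hYm)
      (hXY.comp hA hB)
    rw [← hwint, ← hY.laplace hwm]
    exact hprod
  simp_rw [hterm]
  rw [ENNReal.tsum_mul_right, hX.sum_expNeg_others hum hgm ?_, hgint, huint]
  · ring
  · intro h
    rw [h, ENNReal.mul_top (by simpa using hlX)] at hgint
    exact hIfin hgint.symm

end

/-! ### From fixed levels to an integral over the level -/

/-- The nonnegative reals `l` with `⌊l * N⌋ = j`. -/
def cell (N j : ℕ) : Set ℝ := {l | 0 ≤ l ∧ ⌊l * N⌋₊ = j}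

lemma measurableSet_cell (N j : ℕ) : MeasurableSet (cell N j) := by
  refine measurableSet_Ici.inter (measurableSet_eq_fun ?_ measurable_const)
  exact Nat.measurable_floor.comp (measurable_id.mul_const _)

lemma le_of_mem_cell {N j : ℕ} (hN : 0 < N) {l : ℝ} (h : l ∈ cell N j) : (j : ℝ) / N ≤ l := by
  have hN' : (0 : ℝ) < N := by exact_mod_cast hN
  rw [div_le_iff₀ hN', ← h.2]
  exact Nat.floor_le (mul_nonneg h.1 hN'.le)

lemma lt_of_mem_cell {N j : ℕ} (hN : 0 < N) {l : ℝ} (h : l ∈ cell N j) : l < ((j : ℝ) + 1) / N := by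
  have hN' : (0 : ℝ) < N := by exact_mod_cast hN
  rw [lt_div_iff₀ hN', ← h.2]
  exact Nat.lt_floor_add_one _

lemma lintegral_floor {ν : Measure ℝ} (hν : ν (Iio 0) = 0) (N : ℕ) (F : ℕ → ℝ≥0∞) :
    ∫⁻ l, F ⌊l * N⌋₊ ∂ν = ∑' j, ν (cell N j) * F j := by
  have hm : Measurable fun l : ℝ => ⌊l * N⌋₊ := Nat.measurable_floor.comp (measurable_id.mul_const _)
  rw [← lintegral_map (measurable_of_countable F) hm, lintegral_countable']
  refine tsum_congr fun j => ?_
  rw [Measure.map_apply hm (measurableSet_singleton j), mul_comm]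
  congr 1
  refine measure_congr ?_
  have h0 : ∀ᵐ l ∂ν, 0 ≤ l := by
    rw [ae_iff]
    simpa [not_le, Iio] using hν
  filter_upwards [h0] with l hl
  refine propext ⟨fun h => ⟨hl, h⟩, fun h => h.2⟩

lemma tendsto_floor_div {l : ℝ} (hl : 0 ≤ l) :
    Tendsto (fun m : ℕ => (⌊l * ((m + 1 : ℕ) : ℝ)⌋₊ : ℝ) / ((m + 1 : ℕ) : ℝ)) atTop (𝓝 l) :=
  (tendsto_nat_floor_mul_div_atTop hl).comp (tendsto_natCast_atTop_atTop.comp (tendsto_add_atTop_nat 1))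

lemma tendsto_floor_add_one_div {l : ℝ} (hl : 0 ≤ l) :
    Tendsto (fun m : ℕ => ((⌊l * ((m + 1 : ℕ) : ℝ)⌋₊ : ℝ) + 1) / ((m + 1 : ℕ) : ℝ)) atTop (𝓝 l) := by
  have h := (tendsto_floor_div hl).add (tendsto_one_div_add_atTop_nhds_zero_nat (𝕜 := ℝ))
  rw [add_zero] at h
  refine h.congr fun m => ?_
  push_cast
  rw [add_div]

/-- If `E` happens when some `L n` satisfies the condition `A n c` at a level `c` slightly above it, and
only if some `L n` satisfies it at all lower levels, then the probability of `E` is an integral over the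
value of `L n`. -/
theorem measure_eq_lintegral_of_levels {Ω : Type*} [MeasurableSpace Ω] {P : Measure Ω} [IsFiniteMeasure P]
    {E : Set Ω} {L : ℕ → Ω → ℝ} {A : ℕ → ℝ → Set Ω}
    {ν : Measure ℝ} (hac : ν ≪ volume) (hfin : ∀ M, ν (Iio M) ≠ ∞) (hneg : ν (Iio 0) = 0)
    {φ : ℝ → ℝ≥0∞} (hanti : AntitoneOn φ (Ici 0)) (hone : ∀ c, φ c ≤ 1)
    (hmeas : ∀ n I c, MeasurableSet I → MeasurableSet ({ω | L n ω ∈ I} ∩ A n c))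
    (hup : ∀ᵐ ω ∂P, ω ∈ E → ∃ n, 0 ≤ L n ω ∧ ∀ c, 0 ≤ c → c ≤ L n ω → ω ∈ A n c)
    (hlow : ∀ᵐ ω ∂P, ∀ n c, 0 ≤ L n ω → L n ω < c → ω ∈ A n c → ω ∈ E)
    (huniq : ∀ ω n n' c c', L n ω < c → ω ∈ A n c → L n' ω < c' → ω ∈ A n' c' → n = n')
    (hsum : ∀ I c, MeasurableSet I → ν I ≠ ∞ → 0 ≤ c →
      ∑' n, P ({ω | L n ω ∈ I} ∩ A n c) = ν I * φ c) :
    NullMeasurableSet E P ∧ P E = ∫⁻ l, φ l ∂ν := by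
  -- The extension of `φ` to a monotone function on the line has countably many discontinuities, a
  -- null set for `ν`; so its values at the rounded points converge almost everywhere.
  set ψ : ℝ → ℝ≥0∞ := fun c => φ (max c 0) with hψ
  have hψanti : Antitone ψ := fun x y h =>
    hanti (mem_Ici.2 (le_max_right _ _)) (mem_Ici.2 (le_max_right _ _)) (max_le_max_right 0 h)
  have hψeq : ∀ c, 0 ≤ c → ψ c = φ c := fun c hc => by simp [hψ, max_eq_left hc]
  have h0 : ∀ᵐ l ∂ν, 0 ≤ l := by
    rw [ae_iff]
    simpa [not_le, Iio] using hneg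
  have hcont : ∀ᵐ l ∂ν, ContinuousAt ψ l :=
    hac.ae_le ((hψanti.countable_not_continuousAt.ae_notMem volume).mono fun l hl => by simpa using hl)
  have hφψ : ∫⁻ l, φ l ∂ν = ∫⁻ l, ψ l ∂ν :=
    lintegral_congr_ae (h0.mono fun l hl => (hψeq l hl).symm)
  have hcellfin : ∀ {N : ℕ} (_ : 0 < N) j, ν (cell N j) ≠ ∞ := fun hN j =>
    ((measure_mono fun l hl => lt_of_mem_cell hN hl).trans_lt (lt_top_iff_ne_top.2 (hfin _))).ne
  rw [hφψ]
  have hupper : P E ≤ ∫⁻ l, ψ l ∂ν := by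
    -- Restricting to `L n < M` leaves finite mass, so that the constant `1` dominates.
    set EM : ℕ → Set Ω := fun M =>
      {ω | ∃ n, (0 ≤ L n ω ∧ L n ω < M) ∧ ∀ c, 0 ≤ c → c ≤ L n ω → ω ∈ A n c} with hEM
    have hmono : Monotone EM := by
      rintro M M' h ω ⟨n, ⟨h1, h2⟩, h3⟩
      exact ⟨n, ⟨h1, h2.trans_le (by exact_mod_cast h)⟩, h3⟩
    have hsub : P E ≤ P (⋃ M, EM M) := by
      refine measure_mono_ae ?_
      filter_upwards [hup] with ω hω hE
      obtain ⟨n, h1, h2⟩ := hω hE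
      obtain ⟨M, hM⟩ := exists_nat_gt (L n ω)
      exact mem_iUnion.2 ⟨M, n, ⟨h1, hM⟩, h2⟩
    refine hsub.trans ?_
    rw [hmono.measure_iUnion]
    refine iSup_le fun M => ?_
    have hbound : ∀ m : ℕ, P (EM M) ≤
        ∫⁻ l in Iio (M : ℝ), ψ ((⌊l * ((m + 1 : ℕ) : ℝ)⌋₊ : ℝ) / ((m + 1 : ℕ) : ℝ)) ∂ν := by
      intro m
      have hN : 0 < m + 1 := m.succ_pos
      rw [lintegral_floor (F := fun j => ψ ((j : ℝ) / ((m + 1 : ℕ) : ℝ)))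
        (le_antisymm ((Measure.restrict_apply_le _ _).trans hneg.le) zero_le)]
      -- Rounding down: the condition holds at every level up to `L n`, hence at the lower end of
      -- the cell, and a union bound suffices.
      have hcov : EM M ⊆ ⋃ j, ⋃ n,
          ({ω | L n ω ∈ cell (m + 1) j ∩ Iio (M : ℝ)} ∩ A n ((j : ℝ) / ((m + 1 : ℕ) : ℝ))) := by
        rintro ω ⟨n, ⟨h1, h2⟩, h3⟩
        have hmem : L n ω ∈ cell (m + 1) ⌊L n ω * ((m + 1 : ℕ) : ℝ)⌋₊ := ⟨h1, rfl⟩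
        exact mem_iUnion.2 ⟨_, mem_iUnion.2 ⟨n, ⟨hmem, h2⟩,
          h3 _ (by positivity) (le_of_mem_cell hN hmem)⟩⟩
      refine (measure_mono hcov).trans ((measure_iUnion_le _).trans (ENNReal.tsum_le_tsum fun j => ?_))
      refine (measure_iUnion_le _).trans ?_
      rw [hsum _ _ ((measurableSet_cell _ _).inter measurableSet_Iio)
        ((measure_mono inter_subset_left).trans_lt (hcellfin hN j).lt_top).ne (by positivity),
        Measure.restrict_apply (measurableSet_cell _ _), hψeq _ (by positivity)]
    have hlim : Tendsto (fun m : ℕ =>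
        ∫⁻ l in Iio (M : ℝ), ψ ((⌊l * ((m + 1 : ℕ) : ℝ)⌋₊ : ℝ) / ((m + 1 : ℕ) : ℝ)) ∂ν) atTop
        (𝓝 (∫⁻ l in Iio (M : ℝ), ψ l ∂ν)) := by
      refine tendsto_lintegral_of_dominated_convergence (fun _ => 1) (fun m => ?_)
        (fun m => .of_forall fun l => hone _) (by simpa using hfin M) ?_
      · exact (measurable_of_countable (fun j : ℕ => ψ ((j : ℝ) / ((m + 1 : ℕ) : ℝ)))).comp
          (Nat.measurable_floor.comp (measurable_id.mul_const _))
      · refine ae_restrict_of_ae ?_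
        filter_upwards [h0, hcont] with l hl hc
        exact hc.tendsto.comp (tendsto_floor_div hl)
    exact (ge_of_tendsto' hlim hbound).trans (setLIntegral_le_lintegral _ _)
  have hlower : ∃ S, MeasurableSet S ∧ S ≤ᵐ[P] E ∧ ∫⁻ l, ψ l ∂ν ≤ P S := by
    -- Rounding up: the upper end of the cell exceeds `L n` strictly, so each `B m q` lies in `E`
    -- almost surely. By `huniq` these sets are disjoint for fixed `m`, and Fatou's lemma replaces
    -- domination.
    set B : ℕ → ℕ × ℕ → Set Ω := fun m q =>
      {ω | L q.2 ω ∈ cell (m + 1) q.1} ∩ A q.2 (((q.1 : ℝ) + 1) / ((m + 1 : ℕ) : ℝ)) with hB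
    have hBm : ∀ m q, MeasurableSet (B m q) := fun m q => hmeas _ _ _ (measurableSet_cell _ _)
    refine ⟨⋃ m, ⋃ q, B m q, MeasurableSet.iUnion fun m => MeasurableSet.iUnion fun q => hBm m q,
      ?_, ?_⟩
    · filter_upwards [hlow] with ω hω hmem
      obtain ⟨m, hmem⟩ := mem_iUnion.1 hmem
      obtain ⟨q, h1, h2⟩ := mem_iUnion.1 hmem
      exact hω q.2 _ h1.1 (lt_of_mem_cell m.succ_pos h1) h2
    have hbound : ∀ m : ℕ, ∫⁻ l, ψ (((⌊l * ((m + 1 : ℕ) : ℝ)⌋₊ : ℝ) + 1) / ((m + 1 : ℕ) : ℝ)) ∂ν ≤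
        P (⋃ m, ⋃ q, B m q) := by
      intro m
      have hN : 0 < m + 1 := m.succ_pos
      rw [lintegral_floor hneg (F := fun j => ψ (((j : ℝ) + 1) / ((m + 1 : ℕ) : ℝ)))]
      have hdisj : Pairwise (Function.onFun Disjoint (B m)) := by
        rintro ⟨j, n⟩ ⟨j', n'⟩ hne
        refine disjoint_left.2 ?_
        rintro ω ⟨h1, h2⟩ ⟨h3, h4⟩
        have hn := huniq ω n n' _ _ (lt_of_mem_cell hN h1) h2 (lt_of_mem_cell hN h3) h4
        subst hn
        exact hne (Prod.ext (h1.2.symm.trans h3.2) rfl)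
      refine le_trans (le_of_eq ?_) (measure_mono (subset_iUnion (fun m => ⋃ q, B m q) m))
      rw [measure_iUnion hdisj (hBm m), ENNReal.tsum_prod']
      refine tsum_congr fun j => ?_
      rw [hψeq _ (by positivity)]
      exact (hsum (cell (m + 1) j) (((j : ℝ) + 1) / ((m + 1 : ℕ) : ℝ)) (measurableSet_cell _ _)
        (hcellfin hN j) (by positivity)).symm
    calc ∫⁻ l, ψ l ∂ν
        ≤ ∫⁻ l, liminf (fun m : ℕ =>
            ψ (((⌊l * ((m + 1 : ℕ) : ℝ)⌋₊ : ℝ) + 1) / ((m + 1 : ℕ) : ℝ))) atTop ∂ν := by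
          refine lintegral_mono_ae ?_
          filter_upwards [h0, hcont] with l hl hc
          exact (hc.tendsto.comp (tendsto_floor_add_one_div hl)).liminf_eq.ge
      _ ≤ liminf (fun m : ℕ => ∫⁻ l, ψ (((⌊l * ((m + 1 : ℕ) : ℝ)⌋₊ : ℝ) + 1) /
            ((m + 1 : ℕ) : ℝ)) ∂ν) atTop := by
          refine lintegral_liminf_le fun m => ?_
          exact (measurable_of_countable (fun j : ℕ => ψ (((j : ℝ) + 1) / ((m + 1 : ℕ) : ℝ)))).comp
            (Nat.measurable_floor.comp (measurable_id.mul_const _))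
      _ ≤ P (⋃ m, ⋃ q, B m q) := by
          refine liminf_le_of_le (by isBoundedDefault) fun b hb => ?_
          obtain ⟨m, hm⟩ := hb.exists
          exact hm.trans (hbound m)
  obtain ⟨S, hSm, hSE, hS⟩ := hlower
  refine ⟨?_, le_antisymm hupper (hS.trans (measure_mono_ae hSE))⟩
  -- `E` is not assumed measurable (for the network it is defined through a choice of maximizer). It
  -- almost contains the measurable set `S` of at least the same outer measure, so it differs from
  -- `S` by a null set.
  have hES : P (toMeasurable P E) ≤ P S := by
    rw [measure_toMeasurable]
    exact hupper.trans hS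
  have hEE : E ≤ᵐ[P] toMeasurable P E := (subset_toMeasurable P E).eventuallyLE
  have heq := ae_eq_of_ae_subset_of_measure_ge (hSE.trans hEE) hES hSm.nullMeasurableSet
    (measure_ne_top _ _)
  exact hSm.nullMeasurableSet.congr (hSE.antisymm (hEE.trans heq.symm.le))

/-! ### Almost sure regularity and existence of maximizers -/

section

variable {Ω : Type*} [MeasurableSpace Ω] {P : Measure Ω} [IsProbabilityMeasure P]
  {X : ℕ → Ω → Plane} {lam : ℝ}

lemma IsPoissonProcess.lintegral_tsum (hX : IsPoissonProcess P X lam) {g : Plane → ℝ≥0∞}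
    (hg : Measurable g) :
    ∫⁻ ω, ∑' n, g (X n ω) ∂P = ENNReal.ofReal lam * ∫⁻ x, g x := by
  simpa using hX.campbell_expNeg (u := fun _ => 0) measurable_const hg

lemma IsPoissonProcess.ae_norm_pos (hX : IsPoissonProcess P X lam) :
    ∀ᵐ ω ∂P, ∀ n, 0 < ‖X n ω‖ := by
  rw [ae_all_iff]
  intro n
  have hg : Measurable (({0} : Set Plane).indicator (1 : Plane → ℝ≥0∞)) :=
    measurable_one.indicator (measurableSet_singleton 0)
  have h := hX.lintegral_tsum hg
  have hm : Measurable fun ω => ∑' n, ({0} : Set Plane).indicator (1 : Plane → ℝ≥0∞) (X n ω) :=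
    Measurable.tsum fun k => hg.comp (hX.measurable k)
  rw [lintegral_indicator_one (measurableSet_singleton 0), measure_singleton, mul_zero,
    lintegral_eq_zero_iff hm] at h
  filter_upwards [h] with ω hω
  have h0 := ENNReal.tsum_eq_zero.1 hω n
  rw [norm_pos_iff]
  intro hc
  simp [hc] at h0

/-- The mean number of points in a ball is finite; balls of integer radius suffice. -/
lemma IsPoissonProcess.ae_finite_norm_le (hX : IsPoissonProcess P X lam) :
    ∀ᵐ ω ∂P, ∀ R : ℝ, {n | ‖X n ω‖ ≤ R}.Finite := by
  have hR : ∀ᵐ ω ∂P, ∀ R : ℕ, {n | ‖X n ω‖ ≤ R}.Finite := by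
    rw [ae_all_iff]
    intro R
    have hg : Measurable ((Metric.closedBall (0 : Plane) R).indicator (1 : Plane → ℝ≥0∞)) :=
      measurable_one.indicator measurableSet_closedBall
    have h := hX.lintegral_tsum hg
    rw [lintegral_indicator_one measurableSet_closedBall] at h
    have hfin := ae_lt_top (Measurable.tsum fun k => hg.comp (hX.measurable k))
      (h.trans_lt (ENNReal.mul_lt_top ENNReal.ofReal_lt_top measure_closedBall_lt_top)).ne
    filter_upwards [hfin] with ω hω
    refine (ENNReal.finite_const_le_of_tsum_ne_top hω.ne one_ne_zero).subset fun n hn => ?_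
    have : X n ω ∈ Metric.closedBall (0 : Plane) R := by simpa using hn
    simp [indicator_of_mem this]
  filter_upwards [hR] with ω hω R
  obtain ⟨k, hk⟩ := exists_nat_ge R
  exact (hω k).subset fun n hn => le_trans hn hk

end

lemma norm_le_of_pathloss_le {a : LinkState → ℝ} (ha : ∀ t, 0 < a t) {mu u r C : ℝ} (hr : 0 ≤ r)
    (h : pathloss a mu u r ≤ C) : r ≤ max (C ^ (1 / a .los)) (C ^ (1 / a .nlos)) := by
  have key : ∀ t, r ^ a t ≤ C → r ≤ C ^ (1 / a t) := fun t ht => by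
    have := Real.rpow_le_rpow (Real.rpow_nonneg hr _) ht (one_div_nonneg.2 (ha t).le)
    rwa [← Real.rpow_mul hr, mul_one_div_cancel (ha t).ne', Real.rpow_one] at this
  rw [pathloss_eq] at h
  split_ifs at h
  · exact (key _ h).trans (le_max_left _ _)
  · exact (key _ h).trans (le_max_right _ _)

lemma finite_setOf_pathloss_le {a : LinkState → ℝ} (ha : ∀ t, 0 < a t) {mu : ℝ} {u r : ℕ → ℝ}
    (hr : ∀ n, 0 ≤ r n) (hfin : ∀ R : ℝ, {n | r n ≤ R}.Finite) (C : ℝ) :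
    {n | pathloss a mu (u n) (r n) ≤ C}.Finite :=
  (hfin _).subset fun n hn => norm_le_of_pathloss_le ha (hr n) hn

/-- Only finitely many values reach that of a given index, so the maximum is taken over a finite
set. -/
lemma exists_forall_le_of_finite {ι : Type*} [Nonempty ι] {f : ι → ℝ}
    (hfin : ∀ ε, 0 < ε → {i | ε ≤ f i}.Finite) (hpos : ∀ i, 0 < f i) : ∃ x, ∀ y, f y ≤ f x := by
  obtain ⟨i₀⟩ := ‹Nonempty ι›
  obtain ⟨x, hx, hmax⟩ := Set.exists_max_image _ f (hfin (f i₀) (hpos i₀)) ⟨i₀, le_refl (f i₀)⟩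
  refine ⟨x, fun y => ?_⟩
  rcases le_or_gt (f i₀) (f y) with h | h
  · exact hmax y h
  · exact h.le.trans hx

lemma finite_setOf_le_mul_inv {L : ℕ → ℝ} (hL : ∀ n, 0 < L n) (hfin : ∀ C : ℝ, {n | L n ≤ C}.Finite)
    {K ε : ℝ} (hε : 0 < ε) : {n | ε ≤ K * (L n)⁻¹}.Finite := by
  refine (hfin (K / ε)).subset fun n hn => ?_
  have hn' : ε ≤ K * (L n)⁻¹ := hn
  rw [← div_eq_mul_inv, le_div_iff₀ (hL n)] at hn'
  exact (le_div_iff₀ hε).2 (by rwa [mul_comm])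

/-! ### The factor at a level and its closed form -/

section levels

variable (p : Params)

lemma lossIntensity_ac (lam mu : ℝ) (a : LinkState → ℝ) : lossIntensity lam mu a ≪ volume :=
  (withDensity_absolutelyContinuous _ _).trans Measure.restrict_le_self.absolutelyContinuous

lemma ae_lossIntensity_pos (lam mu : ℝ) (a : LinkState → ℝ) :
    ∀ᵐ l ∂(lossIntensity lam mu a), 0 < l :=
  (withDensity_absolutelyContinuous _ _).ae_le (ae_restrict_mem measurableSet_Ioi)

lemma lintegral_lossIntensity' (lam mu : ℝ) (a : LinkState → ℝ) (f : ℝ → ℝ≥0∞) :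
    ∫⁻ l, f l ∂(lossIntensity lam mu a) =
      ∫⁻ l in Ioi 0, f l * ENNReal.ofReal (lossDensity lam mu a l) := by
  rw [lossIntensity, lintegral_withDensity_eq_lintegral_mul_non_measurable _
    (measurable_lossDensity _ _ _).ennreal_ofReal (.of_forall fun _ => ENNReal.ofReal_lt_top)]
  simp [mul_comm]

/-- The factor by which the intensity of points of pathloss `c` is multiplied in the law of the
pathloss of the serving point. -/
def levelFactor (lX lY mu : ℝ) (aX aY : LinkState → ℝ) (t s w c : ℝ) : ℝ≥0∞ :=
  expNeg (ENNReal.ofReal (t * c)) *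
    expNeg (∫⁻ l, (1 - attenuation p c (s * c) l) ∂(lossIntensity lX mu aX)) *
    expNeg (lossIntensity lY mu aY (Iio (w * c)))

lemma levelFactor_le_one (lX lY mu : ℝ) (aX aY : LinkState → ℝ) (t s w c : ℝ) :
    levelFactor p lX lY mu aX aY t s w c ≤ 1 :=
  mul_le_one' (mul_le_one' (expNeg_le_one _) (expNeg_le_one _)) (expNeg_le_one _)

/-- Raising the level forbids more points and strengthens the interference coefficient; both lower
the factor. -/
lemma attenuation_anti {s c c' l : ℝ} (hs : 0 ≤ s) (hc : 0 ≤ c) (hcc : c ≤ c') (hl : 0 < l) :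
    attenuation p c' (s * c') l ≤ attenuation p c (s * c) l := by
  by_cases h : c' ≤ l
  · rw [attenuation_eq p (mul_nonneg hs (hc.trans hcc)) hl h,
      attenuation_eq p (mul_nonneg hs hc) hl (hcc.trans h)]
    refine ENNReal.ofReal_le_ofReal (Finset.sum_le_sum fun b _ => ?_)
    have hb := p.gainVal_nonneg b
    have := p.gainProb_nonneg b
    gcongr
  · rw [attenuation, if_neg h]
    exact zero_le

lemma antitoneOn_levelFactor (lX lY mu : ℝ) (aX aY : LinkState → ℝ) {t s w : ℝ} (ht : 0 ≤ t)
    (hs : 0 ≤ s) (hw : 0 ≤ w) : AntitoneOn (levelFactor p lX lY mu aX aY t s w) (Ici 0) := by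
  intro c hc c' _ hcc
  unfold levelFactor
  refine mul_le_mul' (mul_le_mul' (antitone_expNeg ?_) (antitone_expNeg ?_)) (antitone_expNeg ?_)
  · exact ENNReal.ofReal_le_ofReal (by gcongr)
  · refine lintegral_mono_ae ?_
    filter_upwards [ae_lossIntensity_pos lX mu aX] with l hl
    exact tsub_le_tsub_left (attenuation_anti p hs hc hcc hl) 1
  · exact measure_mono (Iio_subset_Iio (by gcongr))

variable {p} {Ω : Type*} [MeasurableSpace Ω] {P : Measure Ω} [IsProbabilityMeasure P]
  {m : Fin 4 × ℕ → Ω → ℝ}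

/-- The probability of an event which, up to the choice of a level, is that of `RaceCond` for some
point of a Poisson process. -/
theorem measure_eq_lintegral_levelFactor {X Y : ℕ → Ω → Plane} {lX lY mu : ℝ} (hlX : 0 < lX)
    (hlY : 0 < lY) (hmu : 0 < mu) {aX aY : LinkState → ℝ} (haX : ∀ t, 0 < aX t) (haY : ∀ t, 0 < aY t)
    (hX : IsPoissonProcess P X lX) (hY : IsPoissonProcess P Y lY)
    (hXY : IndepFun (fun ω n => X n ω) (fun ω n => Y n ω) P) (hm : IsMarkField p P m)
    (hpm : IndepFun (fun ω => (fun n => X n ω, fun n => Y n ω)) (fun ω j => m j ω) P)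
    {t s w : ℝ} (ht : 0 ≤ t) (hs : 0 ≤ s) (hw : 0 ≤ w) {E : Set Ω}
    (hup : ∀ᵐ ω ∂P, ω ∈ E → ∃ n, ∀ c, 0 ≤ c → c ≤ pathloss aX mu (m (0, n) ω) ‖X n ω‖ →
      RaceCond aX aY mu univ c (w * c) (s * c) (ENNReal.ofReal (t * c)) n
        (fun k => X k ω) (fun k => Y k ω) fun j => m j ω)
    (hlow : ∀ᵐ ω ∂P, ∀ n c, pathloss aX mu (m (0, n) ω) ‖X n ω‖ < c →
      RaceCond aX aY mu univ c (w * c) (s * c) (ENNReal.ofReal (t * c)) n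
        (fun k => X k ω) (fun k => Y k ω) (fun j => m j ω) → ω ∈ E) :
    NullMeasurableSet E P ∧ P E = ∫⁻ l, levelFactor p lX lY mu aX aY t s w l
      ∂(lossIntensity lX mu aX) := by
  have hXm : Measurable fun ω n => X n ω := measurable_pi_lambda _ hX.measurable
  have hYm : Measurable fun ω n => Y n ω := measurable_pi_lambda _ hY.measurable
  have hmω : Measurable fun ω j => m j ω := measurable_pi_lambda _ hm.measurable
  have hsplit : ∀ n (I : Set ℝ) c,
      {ω | pathloss aX mu (m (0, n) ω) ‖X n ω‖ ∈ I} ∩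
        {ω | RaceCond aX aY mu univ c (w * c) (s * c) (ENNReal.ofReal (t * c)) n
          (fun k => X k ω) (fun k => Y k ω) fun j => m j ω} =
      {ω | RaceCond aX aY mu I c (w * c) (s * c) (ENNReal.ofReal (t * c)) n
          (fun k => X k ω) (fun k => Y k ω) fun j => m j ω} := by
    intro n I c
    ext ω
    simp [RaceCond]
  have hIio0 : lossIntensity lX mu aX (Iio 0) = 0 := by
    rw [lossIntensity_Iio hlX hmu haX le_rfl, lossMeasure_zero lX mu haX, ENNReal.ofReal_zero]
  refine measure_eq_lintegral_of_levels
    (L := fun n ω => pathloss aX mu (m (0, n) ω) ‖X n ω‖)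
    (A := fun n c => {ω | RaceCond aX aY mu univ c (w * c) (s * c) (ENNReal.ofReal (t * c)) n
        (fun k => X k ω) (fun k => Y k ω) fun j => m j ω})
    (lossIntensity_ac _ _ _) (fun M => ?_) hIio0
    (antitoneOn_levelFactor p lX lY mu aX aY ht hs hw) (levelFactor_le_one p lX lY mu aX aY t s w)
    (fun n I c hI => ?_) ?_ ?_ ?_ ?_
  · refine ((measure_mono (Iio_subset_Iio (le_max_left M 0))).trans_lt ?_).ne
    rw [lossIntensity_Iio hlX hmu haX (le_max_right _ _)]
    exact ENNReal.ofReal_lt_top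
  · rw [hsplit]
    exact ((hXm.prodMk hYm).prodMk hmω) (measurableSet_raceCond aX aY mu c _ _ _ n hI)
  · filter_upwards [hup] with ω hω hE
    obtain ⟨n, hn⟩ := hω hE
    exact ⟨n, pathloss_nonneg _ _ _ (norm_nonneg _), hn⟩
  · filter_upwards [hlow] with ω hω n c _ hc hA
    exact hω n c hc hA
  -- Two different winners would give `L n < c ≤ L n' < c' ≤ L n`.
  · intro ω n n' c c' h1 h2 h3 h4
    by_contra hne
    have h5 := h2.2.1 n' (Ne.symm hne)
    have h6 := h4.2.1 n hne
    dsimp only at h1 h3 h5 h6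
    linarith
  · intro I c hI hIfin _
    simp_rw [hsplit]
    rw [sum_measure_raceCond hlX hlY hmu haX haY hX hY hXY hm hpm hI hIfin]
    rfl

end levels

lemma lossMeasure_nonneg {lam mu : ℝ} (hlam : 0 < lam) (hmu : 0 < mu) {alpha : LinkState → ℝ}
    (ha : ∀ t, 0 < alpha t) {c : ℝ} (hc : 0 ≤ c) : 0 ≤ lossMeasure lam mu alpha c := by
  have h : MonotoneOn (lossMeasure lam mu alpha) (Ici 0) := by
    refine monotoneOn_of_deriv_nonneg (convex_Ici 0) (continuous_lossMeasure lam mu ha).continuousOn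
      ?_ ?_ <;> rw [interior_Ici] <;> intro x hx
    · exact (hasDerivAt_lossMeasure lam hmu hx).differentiableAt.differentiableWithinAt
    · rw [(hasDerivAt_lossMeasure lam hmu hx).deriv]
      exact lossDensity_nonneg hlam hmu ha hx
  simpa [lossMeasure_zero lam mu ha] using h (mem_Ici.2 le_rfl) (mem_Ici.2 hc) hc

/-- Below `c` the attenuation is `0`, which produces the void exponent `Λ(c)` of the serving tier;
above `c` the remaining integral is the interference exponent. -/
lemma lintegral_one_sub_attenuation (p : Params) {lam mu : ℝ} (hlam : 0 < lam) (hmu : 0 < mu)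
    {a : LinkState → ℝ} (ha : ∀ t, 0 < a t) {c s : ℝ} (hc : 0 < c) (hs : 0 ≤ s) :
    ∫⁻ l, (1 - attenuation p c s l) ∂(lossIntensity lam mu a) =
      ENNReal.ofReal (lossMeasure lam mu a c) + ∑ b, ∫⁻ z in Ioi c, ENNReal.ofReal
        ((1 - 1 / (1 + s * p.gainVal b / z)) * p.gainProb b * lossDensity lam mu a z) := by
  rw [← lintegral_add_compl _ (measurableSet_Iio (a := c)), compl_Iio]
  congr 1
  · rw [← lossIntensity_Iio hlam hmu ha hc.le, ← setLIntegral_one]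
    refine setLIntegral_congr_fun measurableSet_Iio fun l hl => ?_
    simp [attenuation, if_neg (not_le.2 (mem_Iio.1 hl))]
  · rw [← lintegral_indicator measurableSet_Ici, lintegral_lossIntensity',
      ← lintegral_finsetSum _ fun b _ => ?_]
    · have hind : ∀ l, (Ici c).indicator (fun l => 1 - attenuation p c s l) l *
          ENNReal.ofReal (lossDensity lam mu a l) = (Ici c).indicator
            (fun l => (1 - attenuation p c s l) * ENNReal.ofReal (lossDensity lam mu a l)) l :=
        fun l => by by_cases h : l ∈ Ici c <;> simp [h]
      simp_rw [hind]
      rw [lintegral_indicator measurableSet_Ici, Measure.restrict_restrict measurableSet_Ici,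
        inter_eq_left.2 (Ici_subset_Ioi.2 hc), setLIntegral_congr Ioi_ae_eq_Ici.symm]
      refine setLIntegral_congr_fun measurableSet_Ioi fun l hl => ?_
      have hl' : c < l := hl
      have hl0 : 0 < l := hc.trans hl'
      have hd := lossDensity_nonneg hlam hmu ha hl0
      have hterm : ∀ b, 0 ≤ (1 - 1 / (1 + s * p.gainVal b / l)) * p.gainProb b := fun b => by
        have h1 : 0 ≤ s * p.gainVal b / l := div_nonneg (mul_nonneg hs (p.gainVal_nonneg b)) hl0.le
        refine mul_nonneg (sub_nonneg.2 ?_) (p.gainProb_nonneg b)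
        rw [div_le_one (by positivity)]
        linarith
      rw [attenuation_eq p hs hl0 hl'.le, ← ENNReal.ofReal_one, ← ENNReal.ofReal_sub _
        (Finset.sum_nonneg fun b _ => ?_), ← ENNReal.ofReal_mul', ← ENNReal.ofReal_sum_of_nonneg
        fun b _ => mul_nonneg (hterm b) hd]
      · rw [← Finset.sum_mul]
        congr 2
        simp_rw [sub_mul, Finset.sum_sub_distrib, one_mul, p.sum_gainProb]
        exact congrArg _ (Finset.sum_congr rfl fun b _ => mul_comm _ _)
      · exact hd
      · have h1 : 0 ≤ s * p.gainVal b / l := div_nonneg (mul_nonneg hs (p.gainVal_nonneg b)) hl0.le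
        have := p.gainProb_nonneg b
        positivity
    · have := measurable_lossDensity lam mu a
      fun_prop

lemma levelFactor_eq (p : Params) {lX lY mu : ℝ} (hlX : 0 < lX) (hlY : 0 < lY) (hmu : 0 < mu)
    {aX aY : LinkState → ℝ} (haX : ∀ t, 0 < aX t) (haY : ∀ t, 0 < aY t) {t s w c : ℝ}
    (ht : 0 ≤ t) (hs : 0 ≤ s) (hw : 0 ≤ w) (hc : 0 < c) :
    levelFactor p lX lY mu aX aY t s w c =
      expNeg (∑ b, ∫⁻ z in Ioi c, ENNReal.ofReal
        ((1 - 1 / (1 + s * c * p.gainVal b / z)) * p.gainProb b * lossDensity lX mu aX z)) *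
      ENNReal.ofReal (Real.exp (-(t * c) -
        (lossMeasure lY mu aY (w * c) + lossMeasure lX mu aX c))) := by
  have h1 := lossMeasure_nonneg hlX hmu haX hc.le
  have h2 := lossMeasure_nonneg hlY hmu haY (mul_nonneg hw hc.le)
  rw [levelFactor, lintegral_one_sub_attenuation p hlX hmu haX hc (mul_nonneg hs hc.le),
    lossIntensity_Iio hlY hmu haY (mul_nonneg hw hc.le), expNeg_add,
    expNeg_ofReal (mul_nonneg ht hc.le), expNeg_ofReal h1, expNeg_ofReal h2,
    show -(t * c) - (lossMeasure lY mu aY (w * c) + lossMeasure lX mu aX c) =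
      -(t * c) + -lossMeasure lX mu aX c + -lossMeasure lY mu aY (w * c) by ring,
    Real.exp_add, Real.exp_add, ENNReal.ofReal_mul (by positivity),
    ENNReal.ofReal_mul (by positivity)]
  ring

namespace Params

variable (p : Params)

lemma Omega_pos (i j : Tier) : 0 < p.Omega i j := by
  have h : ∀ i, 0 < p.pow i * p.bias i * p.betaA i * p.gain i := fun i =>
    mul_pos (mul_pos (mul_pos (p.pow_pos i) (p.bias_pos i)) (p.betaA_pos i)) (p.gain_pos i)
  exact div_pos (h i) (h j)

lemma Omega_self (i : Tier) : p.Omega i i = 1 := by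
  have h : ∀ i, 0 < p.pow i * p.bias i * p.betaA i * p.gain i := fun i =>
    mul_pos (mul_pos (mul_pos (p.pow_pos i) (p.bias_pos i)) (p.betaA_pos i)) (p.gain_pos i)
  exact div_self (h i).ne'

/-- The coefficient of `pathloss * (interference + noise power)` in the fading that the serving SBS
needs for the SINR `τ`. -/
def accessScale (τ : ℝ) : ℝ := τ / (p.pow .sbs * p.gain .sbs * p.gainU * p.betaA .sbs)

/-- The coefficient of the pathloss in the fading that the anchor MBS needs for the SNR `τ`. -/
def backhaulScale (τ : ℝ) : ℝ :=
  τ * p.noise * p.bw / (p.pow .mbs * p.betaB * p.gain .mbs * p.gain .sbs)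

lemma accessScale_nonneg {τ : ℝ} (hτ : 0 ≤ τ) : 0 ≤ p.accessScale τ := by
  have h1 := p.pow_pos .sbs
  have h2 := p.gain_pos .sbs
  have h3 := p.betaA_pos .sbs
  have h4 := p.gainU_pos
  unfold accessScale
  positivity

lemma backhaulScale_nonneg {τ : ℝ} (hτ : 0 ≤ τ) : 0 ≤ p.backhaulScale τ := by
  have h1 := p.pow_pos .mbs
  have h2 := p.gain_pos .sbs
  have h3 := p.gain_pos .mbs
  have h4 := p.betaB_pos
  have h5 := p.noise_pos
  have h6 := p.bw_pos
  unfold backhaulScale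
  positivity

lemma lintegral_levelFactor_access {τ : ℝ} (hτ : 0 ≤ τ) :
    ∫⁻ l, levelFactor p (p.dens .sbs) (p.dens .mbs) p.mu (p.alphaA .sbs) (p.alphaA .mbs)
      (p.accessScale τ * (p.noise * p.bw)) (p.accessScale τ * (p.pow .sbs * p.betaA .sbs))
      (p.Omega .mbs .sbs) l ∂(lossIntensity (p.dens .sbs) p.mu (p.alphaA .sbs)) =
      p.accessIntegral τ := by
  have h1 := p.pow_pos .sbs
  have h2 := p.gain_pos .sbs
  have h3 := p.betaA_pos .sbs
  have h4 := p.gainU_pos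
  have hκ := p.accessScale_nonneg hτ
  rw [lintegral_lossIntensity', accessIntegral]
  refine setLIntegral_congr_fun measurableSet_Ioi fun l (hl : 0 < l) => ?_
  rw [levelFactor_eq p (p.dens_pos _) (p.dens_pos _) p.mu_pos (p.alphaA_pos _) (p.alphaA_pos _)
    (mul_nonneg hκ (mul_nonneg p.noise_pos.le p.bw_pos.le)) (mul_nonneg hκ (mul_pos h1 h3).le)
    (p.Omega_pos _ _).le hl, EReal.exp_add, EReal.exp_coe, expNeg]
  have hI : (∑ b, ∫⁻ z in Ioi l, ENNReal.ofReal
      ((1 - 1 / (1 + p.accessScale τ * (p.pow .sbs * p.betaA .sbs) * l * p.gainVal b / z)) *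
        p.gainProb b * lossDensity (p.dens .sbs) p.mu (p.alphaA .sbs) z)) =
      p.interferenceExponent τ l := by
    refine Finset.sum_congr rfl fun b _ => setLIntegral_congr_fun measurableSet_Ioi fun z hz => ?_
    have hz0 : 0 < z := hl.trans hz
    have e : p.accessScale τ * (p.pow .sbs * p.betaA .sbs) * l * p.gainVal b / z =
        τ * p.gainVal b * l / (p.gain .sbs * p.gainU * z) := by
      unfold accessScale
      field_simp
    rw [e, lamA]
  have ht : p.accessScale τ * (p.noise * p.bw) * l =
      τ * p.noise * p.bw * l / (p.pow .sbs * p.betaA .sbs * p.gain .sbs * p.gainU) := by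
    unfold accessScale
    field_simp
  rw [hI, ht, p.Omega_self, one_mul, LamA, LamA, lamA]

/-- With `s = w = 0` the interference exponent and the constraint from the second process both
vanish. -/
lemma lintegral_levelFactor_backhaul {τ : ℝ} (hτ : 0 ≤ τ) (lY : ℝ) (hlY : 0 < lY)
    {aY : LinkState → ℝ} (haY : ∀ t, 0 < aY t) :
    ∫⁻ l, levelFactor p (p.dens .mbs) lY p.mu p.alphaB aY (p.backhaulScale τ) 0 0 l
      ∂(lossIntensity (p.dens .mbs) p.mu p.alphaB) = p.backhaulIntegral τ := by
  rw [lintegral_lossIntensity', backhaulIntegral]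
  refine setLIntegral_congr_fun measurableSet_Ioi fun l (hl : 0 < l) => ?_
  rw [levelFactor_eq p (p.dens_pos _) hlY p.mu_pos p.alphaB_pos haY (p.backhaulScale_nonneg hτ)
    le_rfl le_rfl hl, zero_mul, lossMeasure_zero _ _ haY]
  have ht : p.backhaulScale τ * l =
      τ * p.noise * p.bw * l / (p.pow .mbs * p.betaB * p.gain .mbs * p.gain .sbs) := by
    unfold backhaulScale
    ring
  rw [ht, zero_add, LamB, lamB, ENNReal.ofReal_mul (Real.exp_nonneg _)]
  simp

end Params

/-! ### From SINR and association to conditions at a level -/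

lemma ae_expMeasure_pos : ∀ᵐ h ∂(expMeasure 1), 0 < h := by
  rw [ae_iff]
  have h : {h : ℝ | ¬ 0 < h} = Iic 0 := by
    ext
    simp
  rw [h, ← ofReal_cdf, cdf_expMeasure_eq one_pos]
  simp

lemma mul_sumExcept (n : ℕ) (a : ℝ≥0∞) (f : ℕ → ℝ≥0∞) :
    sumExcept n (fun k => a * f k) = a * sumExcept n f := by
  rw [sumExcept, sumExcept, ← ENNReal.tsum_mul_left]
  exact tsum_congr fun k => by split_ifs <;> simp

/-- A ratio above `τ` means `h > (τ / S) * L * b`, and lowering `L` to `c` only weakens this. An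
infinite `b` is excluded because the ratio would be `0`. -/
lemma ofReal_scale_mul_le {τ S h c L : ℝ} {b : ℝ≥0∞} (hτ : 0 < τ) (hS : 0 < S) (hL : 0 < L)
    (hb : b ≠ 0) (hcL : c ≤ L) (hlt : ENNReal.ofReal τ < ENNReal.ofReal (S * h * L⁻¹) / b) :
    ENNReal.ofReal (τ / S * c) * b ≤ ENNReal.ofReal h := by
  have hbt : b ≠ ∞ := by
    rintro rfl
    simp at hlt
  rw [ENNReal.lt_div_iff_mul_lt (Or.inl hb) (Or.inl hbt)] at hlt
  have hr : 0 < b.toReal := ENNReal.toReal_pos hb hbt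
  rw [← ENNReal.ofReal_toReal hbt, ← ENNReal.ofReal_mul hτ.le, ENNReal.ofReal_lt_ofReal_iff',
    ← div_eq_mul_inv, lt_div_iff₀ hL] at hlt
  rw [← ENNReal.ofReal_toReal hbt, ← ENNReal.ofReal_mul' hr.le]
  refine ENNReal.ofReal_le_ofReal ?_
  rw [div_mul_eq_mul_div, div_mul_eq_mul_div, div_le_iff₀ hS]
  have : τ * c * b.toReal ≤ τ * b.toReal * L := by
    rw [mul_right_comm]
    gcongr
  linarith [hlt.1]

/-- The gap `L < c` makes the inequality strict again. An infinite `b` is excluded because the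
fading is finite. -/
lemma ofReal_lt_div_of_scale_mul_le {τ S h c L : ℝ} {b : ℝ≥0∞} (hτ : 0 < τ) (hS : 0 < S)
    (hL : 0 < L) (hb : b ≠ 0) (hLc : L < c)
    (hle : ENNReal.ofReal (τ / S * c) * b ≤ ENNReal.ofReal h) :
    ENNReal.ofReal τ < ENNReal.ofReal (S * h * L⁻¹) / b := by
  have hc : 0 < c := hL.trans hLc
  have hbt : b ≠ ∞ := by
    rintro rfl
    rw [ENNReal.mul_top (by positivity)] at hle
    simp at hle
  have hr : 0 < b.toReal := ENNReal.toReal_pos hb hbt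
  rw [← ENNReal.ofReal_toReal hbt, ← ENNReal.ofReal_mul' hr.le] at hle
  have hpos : 0 < τ / S * c * b.toReal := by positivity
  have hle' : τ / S * c * b.toReal ≤ h := by
    rcases ENNReal.ofReal_le_ofReal_iff'.1 hle with h | h
    · exact h
    · exact absurd h (not_le.2 hpos)
  rw [div_mul_eq_mul_div, div_mul_eq_mul_div, div_le_iff₀ hS] at hle'
  have : τ * b.toReal * L < τ * c * b.toReal := by
    rw [mul_right_comm τ c]
    gcongr
  have key : τ * b.toReal < S * h * L⁻¹ := by
    rw [← div_eq_mul_inv, lt_div_iff₀ hL]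
    linarith
  rw [ENNReal.lt_div_iff_mul_lt (Or.inl hb) (Or.inl hbt), ← ENNReal.ofReal_toReal hbt,
    ← ENNReal.ofReal_mul hτ.le]
  exact (ENNReal.ofReal_lt_ofReal_iff (lt_trans (by positivity) key)).2 key

/-! ### The events of the network -/

namespace Network

variable {p : Params} {Ω : Type*} [MeasurableSpace Ω] {P : Measure Ω} (N : Network p P)

/-- The marks that determine the access link: those of the SBSs and the blocking variables of the
MBSs. -/
def accessMark : Fin 4 × ℕ → Mark
  | (0, n) => .accessBlock .sbs n
  | (1, n) => .accessFading .sbs n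
  | (2, n) => .accessGain n
  | (3, n) => .accessBlock .mbs n

/-- The marks of the typical backhaul link, completed by access marks. -/
def backhaulMark : Fin 4 × ℕ → Mark
  | (0, n) => .backhaulBlock none n
  | (1, n) => .backhaulFading none n
  | (2, n) => .accessGain n
  | (3, n) => .accessBlock .mbs n

lemma accessMark_injective : Function.Injective accessMark := by
  rintro ⟨i, n⟩ ⟨j, k⟩ h
  fin_cases i <;> fin_cases j <;> simp_all [accessMark]

lemma backhaulMark_injective : Function.Injective backhaulMark := by
  rintro ⟨i, n⟩ ⟨j, k⟩ h
  fin_cases i <;> fin_cases j <;> simp_all [backhaulMark]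

lemma isMarkField_accessMark : IsMarkField p P fun j => N.mark (accessMark j) where
  measurable _ := N.mark_measurable _
  indep := N.mark_indep.precomp accessMark_injective
  law_block n := N.mark_law (.accessBlock .sbs n)
  law_fading n := N.mark_law (.accessFading .sbs n)
  law_gain n := N.mark_law (.accessGain n)
  law_block' n := N.mark_law (.accessBlock .mbs n)

lemma isMarkField_backhaulMark : IsMarkField p P fun j => N.mark (backhaulMark j) where
  measurable _ := N.mark_measurable _
  indep := N.mark_indep.precomp backhaulMark_injective
  law_block n := N.mark_law (.backhaulBlock none n)
  law_fading n := N.mark_law (.backhaulFading none n)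
  law_gain n := N.mark_law (.accessGain n)
  law_block' n := N.mark_law (.accessBlock .mbs n)

lemma indepFun_pts_mark (i j : Tier) (g : Fin 4 × ℕ → Mark) :
    IndepFun (fun ω => (fun n => N.pts i n ω, fun n => N.pts j n ω))
      (fun ω k => N.mark (g k) ω) P :=
  N.pts_mark_indep.comp
    (φ := fun x : Tier × ℕ → Plane => (fun n => x (i, n), fun n => x (j, n)))
    (ψ := fun v : Mark → ℝ => fun k => v (g k)) (by fun_prop) (by fun_prop)

/-- The outcomes at which no base station is at the origin and the points of each tier are locally
finite. -/
def Regular (ω : Ω) : Prop :=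
  (∀ i n, 0 < ‖N.pts i n ω‖) ∧ ∀ (i) (R : ℝ), {n | ‖N.pts i n ω‖ ≤ R}.Finite

lemma ae_regular [IsProbabilityMeasure P] : ∀ᵐ ω ∂P, N.Regular ω := by
  filter_upwards [(N.poisson .mbs).ae_norm_pos, (N.poisson .sbs).ae_norm_pos,
    (N.poisson .mbs).ae_finite_norm_le, (N.poisson .sbs).ae_finite_norm_le] with ω h1 h2 h3 h4
  exact ⟨fun i => by cases i <;> assumption, fun i => by cases i <;> assumption⟩

variable {N} {ω : Ω}

lemma Regular.lossA_pos (hω : N.Regular ω) (x : Tier × ℕ) : 0 < N.lossA x ω :=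
  pathloss_pos _ _ _ (hω.1 _ _)

lemma Regular.lossB_none_pos (hω : N.Regular ω) (m : ℕ) : 0 < N.lossB none m ω :=
  pathloss_pos _ _ _ (by simpa [posS] using hω.1 .mbs m)

lemma Regular.finite_lossA_le (hω : N.Regular ω) (i : Tier) (C : ℝ) :
    {n | N.lossA (i, n) ω ≤ C}.Finite :=
  finite_setOf_pathloss_le (p.alphaA_pos i) (fun _ => norm_nonneg _) (hω.2 i) C

lemma Regular.finite_lossB_none_le (hω : N.Regular ω) (C : ℝ) :
    {n | N.lossB none n ω ≤ C}.Finite :=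
  finite_setOf_pathloss_le p.alphaB_pos (fun _ => norm_nonneg _)
    (by simpa [posS] using hω.2 .mbs) C

lemma Regular.serving_spec (hω : N.Regular ω) (y : Tier × ℕ) :
    N.biasedPower y ω ≤ N.biasedPower (N.serving ω) ω := by
  refine Classical.epsilon_spec (p := fun x => ∀ y, N.biasedPower y ω ≤ N.biasedPower x ω)
    (exists_forall_le_of_finite (fun ε hε => ?_) fun x => ?_) y
  · have h : ∀ i, {n | ε ≤ N.biasedPower (i, n) ω}.Finite := fun i =>
      finite_setOf_le_mul_inv (K := p.pow i * p.bias i * p.betaA i * p.gain i * p.gainU)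
        (fun n => hω.lossA_pos (i, n)) (hω.finite_lossA_le i) hε
    refine (((h .mbs).image (Prod.mk Tier.mbs)).union ((h .sbs).image (Prod.mk Tier.sbs))).subset ?_
    rintro ⟨i, n⟩ hn
    cases i
    · exact Or.inl ⟨n, hn, rfl⟩
    · exact Or.inr ⟨n, hn, rfl⟩
  · have h1 := p.pow_pos x.1
    have h2 := p.bias_pos x.1
    have h3 := p.betaA_pos x.1
    have h4 := p.gain_pos x.1
    have h5 := p.gainU_pos
    have h6 := hω.lossA_pos x
    unfold biasedPower
    positivity

lemma Regular.biasedPower_le_iff (hω : N.Regular ω) (x y : Tier × ℕ) :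
    N.biasedPower y ω ≤ N.biasedPower x ω ↔ p.Omega y.1 x.1 * N.lossA x ω ≤ N.lossA y ω := by
  have hx := hω.lossA_pos x
  have hy := hω.lossA_pos y
  have hU := p.gainU_pos
  have hK : 0 < p.pow x.1 * p.bias x.1 * p.betaA x.1 * p.gain x.1 :=
    mul_pos (mul_pos (mul_pos (p.pow_pos _) (p.bias_pos _)) (p.betaA_pos _)) (p.gain_pos _)
  rw [biasedPower, biasedPower, ← div_eq_mul_inv, ← div_eq_mul_inv, div_le_div_iff₀ hy hx,
    mul_right_comm _ p.gainU, mul_right_comm _ p.gainU, mul_le_mul_iff_left₀ hU, Params.Omega,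
    div_mul_eq_mul_div, div_le_iff₀ hK, mul_comm (N.lossA y ω)]

lemma Regular.lossA_ge_of_serving (hω : N.Regular ω) {n : ℕ} (hn : N.serving ω = (.sbs, n)) {c : ℝ}
    (hc : c ≤ N.lossA (.sbs, n) ω) :
    (∀ k, c ≤ N.lossA (.sbs, k) ω) ∧ ∀ k, p.Omega .mbs .sbs * c ≤ N.lossA (.mbs, k) ω := by
  have h : ∀ y : Tier × ℕ, p.Omega y.1 .sbs * N.lossA (.sbs, n) ω ≤ N.lossA y ω := fun y =>
    (hω.biasedPower_le_iff (.sbs, n) y).1 (hn ▸ hω.serving_spec y)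
  refine ⟨fun k => hc.trans ?_, fun k => ?_⟩
  · simpa [p.Omega_self] using h (.sbs, k)
  · exact (mul_le_mul_of_nonneg_left hc (p.Omega_pos _ _).le).trans (h (.mbs, k))

/-- The gap between the pathloss and `c` makes `n` strictly better than every other station, so the
chosen maximizer can only be `n`. -/
lemma Regular.serving_eq (hω : N.Regular ω) {n : ℕ} {c : ℝ} (hc : N.lossA (.sbs, n) ω < c)
    (h1 : ∀ k, k ≠ n → c ≤ N.lossA (.sbs, k) ω)
    (h2 : ∀ k, p.Omega .mbs .sbs * c ≤ N.lossA (.mbs, k) ω) : N.serving ω = (.sbs, n) := by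
  have h := (hω.biasedPower_le_iff _ _).1 (hω.serving_spec (.sbs, n))
  rcases hx : N.serving ω with ⟨i, k⟩
  rw [hx] at h
  cases i
  -- If an MBS served, its pathloss times `Ω` from SBS to MBS would be at most the pathloss of `n`;
  -- the two ratios are reciprocal, so this contradicts `h2`.
  · have hΩ : p.Omega .sbs .mbs * p.Omega .mbs .sbs = 1 := by
      rw [Params.Omega, Params.Omega, div_mul_div_cancel₀, div_self] <;>
      exact (mul_pos (mul_pos (mul_pos (p.pow_pos _) (p.bias_pos _)) (p.betaA_pos _))
        (p.gain_pos _)).ne'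
    have := mul_le_mul_of_nonneg_left (h2 k) (p.Omega_pos .sbs .mbs).le
    rw [← mul_assoc, hΩ, one_mul] at this
    dsimp only at h
    linarith
  · by_contra hne
    have hk : k ≠ n := fun e => hne (by rw [e])
    have := h1 k hk
    dsimp only at h
    rw [p.Omega_self, one_mul] at h
    linarith

lemma interference_eq {n : ℕ} (hn : N.serving ω = (.sbs, n)) :
    N.interference ω = sumExcept n fun k => ENNReal.ofReal (p.pow .sbs *
      N.mark (.accessFading .sbs k) ω * p.betaA .sbs * N.mark (.accessGain k) ω *
        (N.lossA (.sbs, k) ω)⁻¹) := by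
  rw [interference, sumExcept, hn]
  refine tsum_congr fun k => ?_
  by_cases h : k = n
  · simp [h]
  · rw [if_neg h, if_neg fun e => h (Prod.mk.inj e).2.symm]

lemma sinrA_eq {n : ℕ} (hn : N.serving ω = (.sbs, n)) :
    N.sinrA ω = ENNReal.ofReal (p.pow .sbs * p.gain .sbs * p.gainU * p.betaA .sbs *
      N.mark (.accessFading .sbs n) ω * (N.lossA (.sbs, n) ω)⁻¹) /
        (N.interference ω + ENNReal.ofReal (p.noise * p.bw)) := by
  rw [sinrA, hn]

lemma scale_mul_interference {n : ℕ} (hn : N.serving ω = (.sbs, n)) {κ c : ℝ} (hκ : 0 ≤ κ * c) :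
    ENNReal.ofReal (κ * (p.noise * p.bw) * c) + sumExcept n (fun k => ENNReal.ofReal
      (κ * (p.pow .sbs * p.betaA .sbs) * c * N.mark (.accessFading .sbs k) ω *
        N.mark (.accessGain k) ω * (N.lossA (.sbs, k) ω)⁻¹)) =
    ENNReal.ofReal (κ * c) * (N.interference ω + ENNReal.ofReal (p.noise * p.bw)) := by
  rw [interference_eq hn, mul_add, ← mul_sumExcept, add_comm, ← ENNReal.ofReal_mul hκ]
  congr 1
  · refine sumExcept_congr fun k _ => ?_
    rw [← ENNReal.ofReal_mul hκ]
    congr 1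
    ring
  · congr 1
    ring

lemma Regular.anchor_spec (hω : N.Regular ω) (k : ℕ) :
    N.lossB none (N.anchor none ω) ω ≤ N.lossB none k ω := by
  have h1 := p.pow_pos .mbs
  have h2 := p.betaB_pos
  have h3 := p.gain_pos .mbs
  have h4 := p.gain_pos .sbs
  have h := Classical.epsilon_spec (p := fun m => ∀ k, N.powerB none k ω ≤ N.powerB none m ω)
    (exists_forall_le_of_finite (fun ε hε =>
      finite_setOf_le_mul_inv hω.lossB_none_pos hω.finite_lossB_none_le hε) fun m => by
        have h6 := hω.lossB_none_pos m
        unfold powerB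
        positivity) k
  exact (inv_le_inv₀ (hω.lossB_none_pos _) (hω.lossB_none_pos _)).1
    (le_of_mul_le_mul_left h (by positivity))

lemma Regular.anchor_eq (hω : N.Regular ω) {n : ℕ} {c : ℝ} (hc : N.lossB none n ω < c)
    (h : ∀ k, k ≠ n → c ≤ N.lossB none k ω) : N.anchor none ω = n := by
  by_contra hne
  have := h _ hne
  have := hω.anchor_spec n
  linarith

lemma Regular.lt_snrTypical_iff (hω : N.Regular ω) {τ : ℝ} :
    τ < N.snrTypical ω ↔ p.backhaulScale τ * N.lossB none (N.anchor none ω) ω <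
      N.mark (.backhaulFading none (N.anchor none ω)) ω := by
  have h1 := p.pow_pos .mbs
  have h2 := p.betaB_pos
  have h3 := p.gain_pos .mbs
  have h4 := p.gain_pos .sbs
  have h5 := p.noise_pos
  have h6 := p.bw_pos
  rw [snrTypical, snrB, lt_div_iff₀ (by positivity), ← div_eq_mul_inv,
    lt_div_iff₀ (hω.lossB_none_pos _), Params.backhaulScale, div_mul_eq_mul_div,
    div_lt_iff₀ (by positivity)]
  ring_nf

variable (N) [IsProbabilityMeasure P]

/-- With `t = s = 0` the fading condition is vacuous, and the level theorem applies to association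
alone. Null measurability is what restricting `P` to this event requires. -/
lemma nullMeasurableSet_assocEvent : NullMeasurableSet (N.assocEvent .sbs) P := by
  refine (measure_eq_lintegral_levelFactor (p.dens_pos .sbs) (p.dens_pos .mbs) p.mu_pos
    (p.alphaA_pos .sbs) (p.alphaA_pos .mbs) (N.poisson .sbs) (N.poisson .mbs) N.pts_indep.symm
    N.isMarkField_accessMark (N.indepFun_pts_mark .sbs .mbs accessMark) le_rfl le_rfl
    (p.Omega_pos .mbs .sbs).le ?_ ?_).1
  · filter_upwards [N.ae_regular] with ω hω hE
    have hn : N.serving ω = (.sbs, (N.serving ω).2) := Prod.ext hE rfl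
    refine ⟨(N.serving ω).2, fun c hc0 hc => ?_⟩
    obtain ⟨h1, h2⟩ := hω.lossA_ge_of_serving hn hc
    refine ⟨mem_univ _, fun k _ => h1 k, h2, ?_⟩
    simp [sumExcept]
  · filter_upwards [N.ae_regular] with ω hω n c hc hR
    exact congrArg Prod.fst (hω.serving_eq hc hR.2.1 hR.2.2.1)

/-- Association together with the SINR bound gives `RaceCond` at every level up to the serving
pathloss; conversely `RaceCond` at a level strictly above the pathloss of `n` makes `n` the server
and yields the strict SINR bound. -/
lemma measure_access {τ : ℝ} (hτ : 0 < τ) :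
    P ({ω | ENNReal.ofReal τ < N.sinrA ω} ∩ N.assocEvent .sbs) = p.accessIntegral τ := by
  have hnb : 0 < p.noise * p.bw := mul_pos p.noise_pos p.bw_pos
  have hS : 0 < p.pow .sbs * p.gain .sbs * p.gainU * p.betaA .sbs :=
    mul_pos (mul_pos (mul_pos (p.pow_pos _) (p.gain_pos _)) p.gainU_pos) (p.betaA_pos _)
  have hκ := p.accessScale_nonneg hτ.le
  have hb : ∀ ω, N.interference ω + ENNReal.ofReal (p.noise * p.bw) ≠ 0 := fun ω => by
    simp [hnb]
  rw [← p.lintegral_levelFactor_access hτ.le]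
  refine (measure_eq_lintegral_levelFactor (p.dens_pos .sbs) (p.dens_pos .mbs) p.mu_pos
    (p.alphaA_pos .sbs) (p.alphaA_pos .mbs) (N.poisson .sbs) (N.poisson .mbs) N.pts_indep.symm
    N.isMarkField_accessMark (N.indepFun_pts_mark .sbs .mbs accessMark) (mul_nonneg hκ hnb.le)
    (mul_nonneg hκ (mul_pos (p.pow_pos _) (p.betaA_pos _)).le) (p.Omega_pos .mbs .sbs).le ?_ ?_).2
  · filter_upwards [N.ae_regular] with ω hω hE
    have hn : N.serving ω = (.sbs, (N.serving ω).2) := Prod.ext hE.2 rfl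
    refine ⟨(N.serving ω).2, fun c hc0 hc => ?_⟩
    have hL : c ≤ N.lossA (.sbs, (N.serving ω).2) ω := hc
    have hκc : 0 ≤ p.accessScale τ * c := mul_nonneg hκ hc0
    obtain ⟨h1, h2⟩ := hω.lossA_ge_of_serving hn hL
    refine ⟨mem_univ _, fun k _ => h1 k, h2, ?_⟩
    have hlt : ENNReal.ofReal τ < N.sinrA ω := hE.1
    rw [sinrA_eq hn] at hlt
    have hle := ofReal_scale_mul_le hτ hS (hω.lossA_pos _) (hb ω) hL hlt
    rw [← Params.accessScale, ← scale_mul_interference hn hκc] at hle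
    exact hle
  · filter_upwards [N.ae_regular] with ω hω n c hc hR
    have hn := hω.serving_eq hc hR.2.1 hR.2.2.1
    refine ⟨?_, congrArg Prod.fst hn⟩
    have hc0 : 0 ≤ c := (hω.lossA_pos (.sbs, n)).le.trans hc.le
    have hκc : 0 ≤ p.accessScale τ * c := mul_nonneg hκ hc0
    have hle : ENNReal.ofReal (p.accessScale τ * c) *
        (N.interference ω + ENNReal.ofReal (p.noise * p.bw)) ≤
          ENNReal.ofReal (N.mark (.accessFading .sbs n) ω) := by
      rw [← scale_mul_interference hn hκc]
      exact hR.2.2.2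
    rw [Params.accessScale] at hle
    rw [mem_ofPred_eq, sinrA_eq hn]
    exact ofReal_lt_div_of_scale_mul_le hτ hS (hω.lossA_pos _) (hb ω) hc hle

theorem accessCoverage_eq {τ : ℝ} (hτ : 0 < τ) :
    N.accessCoverage τ = 1 / N.assocProb .sbs * p.accessIntegral τ := by
  rw [accessCoverage, ProbabilityTheory.cond, Measure.smul_apply,
    Measure.restrict_apply₀' N.nullMeasurableSet_assocEvent, N.measure_access hτ, assocProb,
    smul_eq_mul, one_div]

theorem backhaulCoverage_eq {τ : ℝ} (hτ : 0 ≤ τ) :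
    N.backhaulCoverage τ = p.backhaulIntegral τ := by
  have hκ := p.backhaulScale_nonneg hτ
  have hloss : ∀ n ω, pathloss p.alphaB p.mu (N.mark (backhaulMark (0, n)) ω) ‖N.pts .mbs n ω‖ =
      N.lossB none n ω := fun n ω => by simp [lossB, posS, backhaulMark]
  -- For `τ = 0` the condition at a level says nothing about the fading, while the SNR must be
  -- strictly positive; almost sure positivity of the fading fills this gap.
  have hfad : ∀ᵐ ω ∂P, ∀ n, 0 < N.mark (.backhaulFading none n) ω := by
    rw [ae_all_iff]
    intro n
    refine ((N.mark_law (.backhaulFading none n)).ae_iff (p := fun h => 0 < h) ?_).2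
      ae_expMeasure_pos
    exact measurableSet_Ioi.mem
  rw [backhaulCoverage, ← p.lintegral_levelFactor_backhaul hτ _ (p.dens_pos .sbs)
    (p.alphaA_pos .mbs)]
  -- The SBS process and its pathloss exponents are placeholders: at `w = 0` the constraint on them
  -- is `0 ≤ pathloss`.
  refine (measure_eq_lintegral_levelFactor (p.dens_pos .mbs) (p.dens_pos .sbs) p.mu_pos
    p.alphaB_pos (p.alphaA_pos .mbs) (N.poisson .mbs) (N.poisson .sbs) N.pts_indep
    N.isMarkField_backhaulMark (N.indepFun_pts_mark .mbs .sbs backhaulMark) hκ le_rfl le_rfl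
    ?_ ?_).2
  · filter_upwards [N.ae_regular] with ω hω hE
    refine ⟨N.anchor none ω, fun c hc0 hc => ⟨mem_univ _, fun k _ => ?_, fun k => ?_, ?_⟩⟩
    · rw [hloss] at hc ⊢
      exact hc.trans (hω.anchor_spec k)
    · rw [zero_mul]
      exact pathloss_nonneg _ _ _ (norm_nonneg _)
    · rw [hloss] at hc
      have h := (hω.lt_snrTypical_iff).1 hE
      simp only [sumExcept, zero_mul, ENNReal.ofReal_zero, ite_self, tsum_zero, add_zero]
      exact ENNReal.ofReal_le_ofReal ((mul_le_mul_of_nonneg_left hc hκ).trans h.le)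
  · filter_upwards [N.ae_regular, hfad] with ω hω hfad n c hc hR
    simp only [RaceCond, hloss] at hc hR
    obtain ⟨-, h1, -, h2⟩ := hR
    have hn := hω.anchor_eq hc h1
    rw [hω.lt_snrTypical_iff, hn]
    have hh : 0 < N.mark (.backhaulFading none n) ω := hfad n
    simp only [sumExcept, zero_mul, ENNReal.ofReal_zero, ite_self, tsum_zero, add_zero] at h2
    have h3 : p.backhaulScale τ * c ≤ N.mark (.backhaulFading none n) ω :=
      (ENNReal.ofReal_le_ofReal_iff hh.le).1 h2
    rcases hκ.eq_or_lt with h0 | h0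
    · rwa [← h0, zero_mul]
    · exact (mul_lt_mul_of_pos_left hc h0).trans_le h3

end Network

end IAB

end

theorem mainTheorem3 {Ω : Type*} [MeasurableSpace Ω] (P : Measure Ω) [IsProbabilityMeasure P]
    (p : IAB.Params) (N : IAB.Network p P) (τ₁ τ₂ : ℝ) (hτ₁ : 0 < τ₁) (hτ₂ : 0 ≤ τ₂) :
    N.accessCoverage τ₁ = 1 / N.assocProb .sbs * p.accessIntegral τ₁ ∧
    N.backhaulCoverage τ₂ = p.backhaulIntegral τ₂ ∧
    (N.jointCoverage τ₁ τ₂ = N.accessCoverage τ₁ * N.backhaulCoverage τ₂ →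
      N.jointCoverage τ₁ τ₂ =
        1 / N.assocProb .sbs * p.accessIntegral τ₁ * p.backhaulIntegral τ₂) := by
  refine ⟨N.accessCoverage_eq hτ₁, N.backhaulCoverage_eq hτ₂, fun h => ?_⟩
  rw [h, N.accessCoverage_eq hτ₁, N.backhaulCoverage_eq hτ₂]
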